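/- Let $E$ be a real normed plane (a two-dimensional real normed space) that is not angled, i.e. there are no three non-collinear points $a,b,c\in E$ such that both segments $[a,b]$ and $[b,c]$ are contained in the unit sphere of $E$. A bounded set $C\subset E$ is called complete if no set of the same diameter properly contains $C$; a completion of a set $S\subset E$ is a complete set containing $S$ and having the same diameter as $S$; and $S$ is a set of unique completion if it has exactly one completion. For a bounded set $S$ of diameter $d$ and an integer $k\ge 0$, let $a_k(S)$ denote the smallest cardinality of a family $\mathcal F$ of subsets of $S$ (with repetitions allowed, i.e. cardinality and membership are counted with multiplicity), each of diameter strictly less than $d$, such that every point of $S$ belongs to at least $k$ members of $\mathcal F$; put $a_k(S)=\infty$ if no finite family of this kind exists (which happens only if $d=0$, $S\ne\emptyset$ and $k\ge 1$). If $S\subset E$ is a set of unique completion and $C$ is its completion, then $a_k(S)=a_k(C)$ for every $k$. -/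

import Mathlib

namespace BorsukCovering

/-- A normed space is *angled* if its unit sphere contains two segments `[a, b]` and `[b, c]`
with `a`, `b`, `c` not collinear. -/
def IsAngled (E : Type*) [NormedAddCommGroup E] [NormedSpace ℝ E] : Prop :=
  ∃ a b c : E, ¬ Collinear ℝ {a, b, c} ∧
    segment ℝ a b ∪ segment ℝ b c ⊆ Metric.sphere (0 : E) 1

/-- A bounded set is *(diametrically) complete* if no set of the same diameter properly
contains it. The diameter is taken in `[0, ∞]`, so unbounded sets have diameter `∞`. -/
def IsDiamComplete {X : Type*} [PseudoMetricSpace X] (C : Set X) : Prop :=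
  Bornology.IsBounded C ∧ ∀ D : Set X, C ⊂ D → Metric.ediam D ≠ Metric.ediam C

/-- `C` is a *completion* of `S`: a complete set containing `S`, of the same diameter as `S`. -/
def IsCompletionOf {X : Type*} [PseudoMetricSpace X] (C S : Set X) : Prop :=
  IsDiamComplete C ∧ S ⊆ C ∧ Metric.ediam C = Metric.ediam S

/-- `S` is a *set of unique completion*. Such a set is bounded, as its completion is. -/
def IsSetOfUniqueCompletion {X : Type*} [PseudoMetricSpace X] (S : Set X) : Prop :=
  ∃! C : Set X, IsCompletionOf C S

/-- A *`k`-fold Borsuk covering* of `S`: an indexed family (members may repeat) of subsets of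
`S` of diameter strictly less than that of `S`, such that every point of `S` belongs to at
least `k` members. -/
def IsKFoldBorsukCovering {X : Type*} [PseudoMetricSpace X] {ι : Type*}
    (k : ℕ) (S : Set X) (F : ι → Set X) : Prop :=
  (∀ i, F i ⊆ S ∧ Metric.ediam (F i) < Metric.ediam S) ∧
    ∀ x ∈ S, (k : ℕ∞) ≤ {i | x ∈ F i}.encard

/-- The *`k`-fold Borsuk number* `a_k(S)`: the smallest cardinality of a `k`-fold Borsuk
covering of `S` (`⊤` if there is no finite one). -/
noncomputable def kFoldBorsukNumber {X : Type*} [PseudoMetricSpace X]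
    (k : ℕ) (S : Set X) : ℕ∞ :=
  sInf {N : ℕ∞ | ∃ m : ℕ, N = (m : ℕ∞) ∧
    ∃ F : Fin m → Set X, IsKFoldBorsukCovering k S F}

end BorsukCovering

namespace BorsukCovering

/-! ### Norming functionals, pairs of diameters in the plane, and planes that are not angled. -/

section Normed

variable {E : Type*} [NormedAddCommGroup E] [NormedSpace ℝ E]

/-! Let `d > 0` be the diameter of `S`. Uniqueness forces the completion `C` to be the intersection
of the balls of radius `d` centred in `S`, or equally in the compact set `closure S`. A compact
subset of `C` has diameter less than `d` as soon as it contains no pair at distance `d`, so all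
depends on the sets `opposite C d z`.

The heart is `exists_dominating`: each point of `C` outside `closure S` has a neighbourhood in `C`
whose points `z` all satisfy `opposite C d z ⊆ opposite C d s` for one `s ∈ closure S`. Given a
covering of `S`, thicken each member slightly and cover the rest of `C` by finitely many such
neighbourhoods, adding each one to the members whose closure contains its `s`. A pair at distance
`d` in a new member would pass to the dominating points and give such a pair in the thickened old
member.

Domination rests on the fact that two diameters of a plane set cross, up to a strip case
(`segments_meet_or_strip`). A ray leaves `C` at a point with an opposite point `w` in the compact
set, and crossing confines `w`. If the points opposite to `x` did not form a convex set, a suitable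
ray from `x` would force `w = x`; this is where the plane must not be angled. So `opposite C d x` is
a segment, and a point opposite to its midpoint is opposite to all of it. For `z` near `x`, either
the opposite sets share a point, and then a supporting line argument gives inclusion, or they are
disjoint, and then the same confinement puts a point of the compact set near `x`. -/

theorem exists_norming_functional (v : E) :
    ∃ g : E →L[ℝ] ℝ, (∀ u, g u ≤ ‖u‖) ∧ g v = ‖v‖ := by
  obtain ⟨g, hg, hv⟩ := exists_dual_vector'' ℝ v
  refine ⟨g, fun u => ?_, by simpa using hv⟩
  calc g u ≤ ‖g u‖ := le_abs_self _
    _ ≤ ‖g‖ * ‖u‖ := g.le_opNorm u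
    _ ≤ 1 * ‖u‖ := by gcongr
    _ = ‖u‖ := one_mul _

/-- A functional that norms `y - x` at a point `y` of the open segment `]u, v[` is constant on
the segment, provided that `u` and `v` are no farther from `x` than `y`. -/
theorem eq_of_norming_of_mem_openSegment {x y u v : E} {d : ℝ} {g : E →L[ℝ] ℝ}
    (hg : ∀ e, g e ≤ ‖e‖) (hy : y ∈ openSegment ℝ u v) (hu : ‖u - x‖ ≤ d) (hv : ‖v - x‖ ≤ d)
    (hgy : g (y - x) = d) {q : E} (hq : q ∈ segment ℝ u v) : g (q - x) = d := by
  obtain ⟨a, b, ha, hb, hab, rfl⟩ := hy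
  obtain ⟨a', b', ha', hb', hab', rfl⟩ := hq
  have h1 := (hg (u - x)).trans hu
  have h2 := (hg (v - x)).trans hv
  simp only [map_sub, map_add, map_smul, smul_eq_mul] at *
  obtain rfl : b = 1 - a := by linarith
  obtain rfl : b' = 1 - a' := by linarith
  have h3 : g u - g x = d := by nlinarith
  have h4 : g v - g x = d := by nlinarith
  linear_combination a' * h3 + (1 - a') * h4

theorem norm_sub_le_of_mem_segment {x u v : E} {d : ℝ} (hu : ‖u - x‖ ≤ d) (hv : ‖v - x‖ ≤ d)
    {q : E} (hq : q ∈ segment ℝ u v) : ‖q - x‖ ≤ d := by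
  have := (convex_closedBall x d).segment_subset (mem_closedBall_iff_norm.2 hu)
    (mem_closedBall_iff_norm.2 hv) hq
  exact mem_closedBall_iff_norm.1 this

theorem norm_sub_eq_of_mem_openSegment {x y u v : E} {d : ℝ}
    (hy : y ∈ openSegment ℝ u v) (hu : ‖u - x‖ ≤ d) (hv : ‖v - x‖ ≤ d)
    (hyx : ‖y - x‖ = d) {q : E} (hq : q ∈ segment ℝ u v) : ‖q - x‖ = d := by
  obtain ⟨g, hg, hgy⟩ := exists_norming_functional (y - x)
  refine (norm_sub_le_of_mem_segment hu hv hq).antisymm ?_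
  rw [← eq_of_norming_of_mem_openSegment hg hy hu hv (hgy.trans hyx) hq]
  exact hg _

/-- Radon's argument for sign pattern two against two: moving the negative terms across and
normalising gives one point with two convex representations. -/
theorem exists_mem_segment_inter_of_relation {x y z w : E} {a b c e : ℝ} (ha : 0 ≤ a)
    (hb : 0 ≤ b) (hc : c ≤ 0) (he : e ≤ 0) (hs : a + b + c + e = 0)
    (hr : a • x + b • y + c • z + e • w = 0) (h0 : ¬ (a = 0 ∧ b = 0 ∧ c = 0 ∧ e = 0)) :
    ∃ p, p ∈ segment ℝ x y ∧ p ∈ segment ℝ z w := by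
  have hpos : 0 < a + b := by
    rcases (add_nonneg ha hb).lt_or_eq with h | h
    · exact h
    · exact absurd ⟨by linarith, by linarith, by linarith, by linarith⟩ h0
  refine ⟨(a / (a + b)) • x + (b / (a + b)) • y,
    ⟨_, _, by positivity, by positivity, by field_simp, rfl⟩,
    ⟨-c / (a + b), -e / (a + b), div_nonneg (by linarith) hpos.le,
      div_nonneg (by linarith) hpos.le, ?_, ?_⟩⟩
  · field_simp
    linarith
  · linear_combination (norm := module) (-(a + b)⁻¹) • hr

/-- Sign pattern one against three: `x` is a convex combination of `y`, `z`, `w`. As `z` and `w` are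
within `d` of `y`, any weight on `y` would bring `x` closer to `y` than `d`. -/
theorem mem_segment_of_relation {x y z w : E} {a b c e d : ℝ} (ha : 0 ≤ a)
    (hb : b ≤ 0) (hc : c ≤ 0) (he : e ≤ 0) (hs : a + b + c + e = 0)
    (hr : a • x + b • y + c • z + e • w = 0) (h0 : ¬ (a = 0 ∧ b = 0 ∧ c = 0 ∧ e = 0))
    (hd : 0 < d) (hxy : ‖x - y‖ = d) (hzy : ‖z - y‖ ≤ d) (hwy : ‖w - y‖ ≤ d) :
    x ∈ segment ℝ z w := by
  have h1 : a • (x - y) = (-c) • (z - y) + (-e) • (w - y) := by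
    obtain rfl : b = -a - c - e := by linarith
    linear_combination (norm := module) hr
  have h2 : a * d ≤ (-c) * d + (-e) * d := by
    calc a * d = ‖a • (x - y)‖ := by rw [norm_smul, hxy, Real.norm_of_nonneg ha]
      _ ≤ ‖(-c) • (z - y)‖ + ‖(-e) • (w - y)‖ := by rw [h1]; exact norm_add_le _ _
      _ ≤ _ := by
        rw [norm_smul, norm_smul, Real.norm_of_nonneg (by linarith : 0 ≤ -c),
          Real.norm_of_nonneg (by linarith : 0 ≤ -e)]
        gcongr <;> linarith
  have hb0 : b = 0 := le_antisymm hb (by nlinarith)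
  subst hb0
  have hpos : 0 < a := by
    rcases ha.lt_or_eq with h | h
    · exact h
    · exact absurd ⟨by linarith, rfl, by linarith, by linarith⟩ h0
  refine ⟨-c / a, -e / a, div_nonneg (by linarith) hpos.le, div_nonneg (by linarith) hpos.le,
    ?_, ?_⟩
  · field_simp
    linarith
  · have : (a⁻¹ * a) • x = x := by rw [inv_mul_cancel₀ hpos.ne', one_smul]
    linear_combination (norm := module) (-a⁻¹) • hr + this

/-- If the side `[x, z]` meets the side `[y, w]` in `m` while all distances are at most
`d = ‖x - y‖ = ‖z - w‖`, then either `[x, y]` meets `[z, w]`, or the four points lie on two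
parallel lines at distance `d`. -/
theorem exists_mem_or_exists_strip {x y z w m : E} {d : ℝ} (hxy : ‖x - y‖ = d)
    (hzw : ‖z - w‖ = d) (hxz : ‖x - z‖ ≤ d) (hyw : ‖y - w‖ ≤ d)
    (hm : m ∈ segment ℝ x z) (hm' : m ∈ segment ℝ y w) :
    (∃ p, p ∈ segment ℝ x y ∧ p ∈ segment ℝ z w) ∨
    ∃ g : E →L[ℝ] ℝ, (∀ u, g u ≤ ‖u‖) ∧ g (y - x) = d ∧ g (z - w) = d ∧ g (y - w) = d ∧
      g (z - x) = d := by
  have e1 := dist_add_dist_of_mem_segment hm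
  have e2 := dist_add_dist_of_mem_segment hm'
  have t1 := dist_triangle x m y
  have t2 := dist_triangle z m w
  simp only [dist_eq_norm] at e1 e2 t1 t2
  rw [norm_sub_rev m y] at t1
  rw [norm_sub_rev z m] at t2
  -- The two triangle inequalities through `m` give `2d ≤ ‖x - z‖ + ‖y - w‖ ≤ 2d`, so equality holds
  -- throughout. A functional norming `y - x` then norms both legs `m - x` and `y - m`, hence by
  -- scaling `z - x` and `y - w`.
  have hxz' : ‖x - z‖ = d := by linarith
  have hyw' : ‖y - w‖ = d := by linarith
  have s1 : ‖x - m‖ + ‖y - m‖ = d := by linarith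
  have s2 : ‖m - z‖ + ‖m - w‖ = d := by linarith
  obtain ⟨g, hg, hgy⟩ := exists_norming_functional (y - x)
  rw [norm_sub_rev, hxy] at hgy
  by_cases hmx : m = x
  · subst hmx
    left
    have : ‖m - w‖ = 0 := by simp at s1; linarith
    rw [norm_sub_eq_zero_iff] at this
    exact ⟨m, left_mem_segment _ _ _, this ▸ right_mem_segment _ _ _⟩
  by_cases hmy : m = y
  · subst hmy
    left
    have : ‖m - z‖ = 0 := by simp at s1; linarith
    rw [norm_sub_eq_zero_iff] at this
    exact ⟨m, right_mem_segment _ _ _, this ▸ left_mem_segment _ _ _⟩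
  right
  have g1 := hg (m - x)
  have g2 := hg (y - m)
  have g3 : g (y - x) = g (y - m) + g (m - x) := by rw [← map_add]; simp
  rw [norm_sub_rev] at g1
  have g4 : g (m - x) = ‖x - m‖ := by linarith
  have g5 : g (y - m) = ‖y - m‖ := by linarith
  have hz : g (z - x) = d := by
    obtain ⟨t, ht, rfl⟩ := (segment_eq_image' ℝ x z).subset hm
    have ht0 : 0 < t := lt_of_le_of_ne ht.1 (by rintro rfl; simp at hmx)
    simp only [add_sub_cancel_left, map_smul, smul_eq_mul, sub_add_cancel_left, norm_neg,
      norm_smul, Real.norm_of_nonneg ht.1] at g4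
    rw [norm_sub_rev, hxz'] at g4
    exact mul_left_cancel₀ ht0.ne' g4
  have hw : g (y - w) = d := by
    obtain ⟨t, ht, rfl⟩ := (segment_eq_image' ℝ y w).subset hm'
    have ht0 : 0 < t := lt_of_le_of_ne ht.1 (by rintro rfl; simp at hmy)
    have e : y - (y + t • (w - y)) = t • (y - w) := by module
    simp only [e, map_smul, smul_eq_mul, norm_smul, Real.norm_of_nonneg ht.1, hyw'] at g5
    exact mul_left_cancel₀ ht0.ne' g5
  refine ⟨g, hg, hgy, ?_, hw, hz⟩
  simp only [map_sub] at *
  linarith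

theorem exists_affine_relation (hdim : Module.finrank ℝ E = 2) (x y z w : E) :
    ∃ a b c e : ℝ, a + b + c + e = 0 ∧ a • x + b • y + c • z + e • w = 0 ∧
      ¬ (a = 0 ∧ b = 0 ∧ c = 0 ∧ e = 0) := by
  have : Module.Finite ℝ E := Module.finite_of_finrank_eq_succ hdim
  have h : ¬ LinearIndependent ℝ ![y - x, z - x, w - x] := fun h => by
    have := h.fintype_card_le_finrank
    simp [hdim] at this
  obtain ⟨c, hc, i, hi⟩ := Fintype.not_linearIndependent_iff.1 h
  simp only [Fin.sum_univ_three, Matrix.cons_val_zero, Matrix.cons_val_one, Matrix.cons_val]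
    at hc
  refine ⟨-(c 0 + c 1 + c 2), c 0, c 1, c 2, by ring, ?_, ?_⟩
  · rw [← hc]; module
  · rintro ⟨-, h0, h1, h2⟩
    fin_cases i
    exacts [hi h0, hi h1, hi h2]

/-- Two segments of length `d` in a plane set of diameter `d` meet, or their end points lie on two
parallel lines at distance `d`. -/
theorem segments_meet_or_strip (hdim : Module.finrank ℝ E = 2) {x y z w : E} {d : ℝ}
    (hd : 0 < d) (hxy : ‖x - y‖ = d) (hzw : ‖z - w‖ = d) (hxz : ‖x - z‖ ≤ d)
    (hxw : ‖x - w‖ ≤ d) (hyz : ‖y - z‖ ≤ d) (hyw : ‖y - w‖ ≤ d) :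
    (∃ p, p ∈ segment ℝ x y ∧ p ∈ segment ℝ z w) ∨
    (∃ g : E →L[ℝ] ℝ, (∀ u, g u ≤ ‖u‖) ∧ g (y - x) = d ∧ g (w - z) = d ∧ g (w - x) = d ∧
      g (y - z) = d) ∨
    (∃ g : E →L[ℝ] ℝ, (∀ u, g u ≤ ‖u‖) ∧ g (y - x) = d ∧ g (z - w) = d ∧ g (z - x) = d ∧
      g (y - w) = d) := by
  obtain ⟨a, b, c, e, hs, hr, h0⟩ := exists_affine_relation hdim x y z w
  have hs' : -a + -b + -c + -e = 0 := by linarith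
  have hr' : (-a) • x + (-b) • y + (-c) • z + (-e) • w = 0 := by
    linear_combination (norm := module) (-1 : ℝ) • hr
  have h0' : ¬ (-a = 0 ∧ -b = 0 ∧ -c = 0 ∧ -e = 0) := by simpa using h0
  -- the four kinds of sign patterns, up to a change of sign
  have k1 : ∀ a b c e : ℝ, a + b + c + e = 0 → a • x + b • y + c • z + e • w = 0 →
      ¬ (a = 0 ∧ b = 0 ∧ c = 0 ∧ e = 0) → 0 ≤ a →
      ((∃ p, p ∈ segment ℝ x y ∧ p ∈ segment ℝ z w) ∨
      (∃ g : E →L[ℝ] ℝ, (∀ u, g u ≤ ‖u‖) ∧ g (y - x) = d ∧ g (w - z) = d ∧ g (w - x) = d ∧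
        g (y - z) = d) ∨
      (∃ g : E →L[ℝ] ℝ, (∀ u, g u ≤ ‖u‖) ∧ g (y - x) = d ∧ g (z - w) = d ∧ g (z - x) = d ∧
        g (y - w) = d)) := by
    clear hs hr h0 hs' hr' h0' a b c e
    intro a b c e hs hr h0 ha
    have hr' : (-a) • x + (-b) • y + (-c) • z + (-e) • w = 0 := by
      linear_combination (norm := module) (-1 : ℝ) • hr
    rcases le_total 0 b with hb | hb <;> rcases le_total 0 c with hc | hc <;>
      rcases le_total 0 e with he | he
    · exact absurd ⟨by linarith, by linarith, by linarith, by linarith⟩ h0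
    · -- `w` against the others
      left
      refine ⟨w, ?_, right_mem_segment _ _ _⟩
      exact mem_segment_of_relation (x := w) (y := z) (a := -e) (b := -c) (c := -a) (e := -b)
        (by linarith) (by linarith) (by linarith) (by linarith) (by linarith)
        (by rw [← hr']; module) (fun h => h0 ⟨by linarith, by linarith, by linarith, by linarith⟩)
        hd (by rw [norm_sub_rev, hzw]) hxz hyz
    · left
      refine ⟨z, ?_, left_mem_segment _ _ _⟩
      exact mem_segment_of_relation (x := z) (y := w) (a := -c) (b := -e) (c := -a) (e := -b)
        (by linarith) (by linarith) (by linarith) (by linarith) (by linarith)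
        (by rw [← hr']; module) (fun h => h0 ⟨by linarith, by linarith, by linarith, by linarith⟩)
        hd hzw hxw hyw
    · exact Or.inl (exists_mem_segment_inter_of_relation ha hb hc he hs hr h0)
    · left
      refine ⟨y, right_mem_segment _ _ _, ?_⟩
      exact mem_segment_of_relation (x := y) (y := x) (a := -b) (b := -a) (c := -c) (e := -e)
        (by linarith) (by linarith) (by linarith) (by linarith) (by linarith)
        (by rw [← hr']; module) (fun h => h0 ⟨by linarith, by linarith, by linarith, by linarith⟩)
        hd (by rw [norm_sub_rev, hxy]) (by rwa [norm_sub_rev]) (by rwa [norm_sub_rev])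
    -- The Radon point lies on the wrong pair of segments; this and the next case are the source of
    -- the two strips.
    · obtain ⟨m, hm, hm'⟩ := exists_mem_segment_inter_of_relation (x := x) (y := z) (z := y)
        (w := w) ha hc hb he (by linarith) (by rw [← hr]; module) (by tauto)
      rcases exists_mem_or_exists_strip hxy hzw hxz hyw hm hm' with h | ⟨g, h1, h2, h3, h4, h5⟩
      exacts [Or.inl h, Or.inr (Or.inr ⟨g, h1, h2, h3, h5, h4⟩)]
    · obtain ⟨m, hm, hm'⟩ := exists_mem_segment_inter_of_relation (x := x) (y := w) (z := y)
        (w := z) ha he hb hc (by linarith) (by rw [← hr]; module) (by tauto)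
      rcases exists_mem_or_exists_strip hxy (by rw [norm_sub_rev, hzw]) hxw hyz hm hm'
        with ⟨p, h, h'⟩ | ⟨g, h1, h2, h3, h4, h5⟩
      exacts [Or.inl ⟨p, h, segment_symm ℝ w z ▸ h'⟩, Or.inr (Or.inl ⟨g, h1, h2, h3, h5, h4⟩)]
    · left
      refine ⟨x, left_mem_segment _ _ _, ?_⟩
      exact mem_segment_of_relation (x := x) (y := y) (a := a) (b := b) (c := c) (e := e)
        ha hb hc he hs hr h0 hd hxy (by rwa [norm_sub_rev]) (by rwa [norm_sub_rev])
  rcases le_total 0 a with ha | ha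
  · exact k1 a b c e hs hr h0 ha
  · exact k1 (-a) (-b) (-c) (-e) hs' hr' h0' (by linarith)

theorem linearIndependent_pair_of_norm_eq {u v : E} {d : ℝ} (hd : 0 < d) (hu : ‖u‖ = d) (hv : ‖v‖ = d)
    (huv : ‖u - v‖ ≤ d) (hne : u ≠ v) : LinearIndependent ℝ ![u, v] := by
  have hu0 : u ≠ 0 := by rintro rfl; simp at hu; linarith
  rw [LinearIndependent.pair_iff' hu0]
  rintro a rfl
  rw [norm_smul, hu, Real.norm_eq_abs] at hv
  have ha : |a| = 1 := by field_simp at hv; exact hv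
  rcases abs_eq (by norm_num : (0 : ℝ) ≤ 1) |>.1 ha with rfl | rfl
  · simp at hne
  · have : u - (-1 : ℝ) • u = (2 : ℝ) • u := by module
    rw [this, norm_smul, hu] at huv
    norm_num at huv
    linarith

theorem exists_coordinates (hdim : Module.finrank ℝ E = 2) {u v : E}
    (h : LinearIndependent ℝ ![u, v]) :
    ∃ φ ψ : E →ₗ[ℝ] ℝ, φ u = 1 ∧ φ v = 0 ∧ ψ u = 0 ∧ ψ v = 1 ∧ ∀ e, e = φ e • u + ψ e • v := by
  let B := basisOfLinearIndependentOfCardEqFinrank h (by simp [hdim])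
  have hB : ⇑B = ![u, v] := coe_basisOfLinearIndependentOfCardEqFinrank h _
  have h0 : B 0 = u := by rw [hB]; rfl
  have h1 : B 1 = v := by rw [hB]; rfl
  refine ⟨B.coord 0, B.coord 1, ?_, ?_, ?_, ?_, fun e => ?_⟩
  · rw [← h0]; simp
  · rw [← h1]; simp
  · rw [← h0]; simp
  · rw [← h1]; simp
  · conv_lhs => rw [← B.sum_repr e]
    rw [Fin.sum_univ_two, h0, h1]; rfl

/-- Transports the hypothesis on the unit sphere to any sphere by translation and scaling. -/
theorem collinear_of_segments_subset_sphere (hE : ¬ IsAngled E) {a b c x : E} {d : ℝ} (hd : 0 < d)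
    (hab : ∀ q ∈ segment ℝ a b, ‖q - x‖ = d) (hbc : ∀ q ∈ segment ℝ b c, ‖q - x‖ = d) :
    Collinear ℝ {a, b, c} := by
  by_contra hcol
  refine hE ⟨d⁻¹ • (a - x), d⁻¹ • (b - x), d⁻¹ • (c - x), fun h => hcol ?_, ?_⟩
  · obtain ⟨v, hv⟩ := (collinear_iff_of_mem (Set.mem_insert _ _)).1 h
    refine (collinear_iff_of_mem (Set.mem_insert a _)).2 ⟨d • v, ?_⟩
    have key : ∀ p : E, (∃ r : ℝ, d⁻¹ • (p - x) = r • v +ᵥ d⁻¹ • (a - x)) →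
        ∃ r : ℝ, p = r • d • v +ᵥ a := by
      rintro p ⟨r, hr⟩
      refine ⟨r, ?_⟩
      have := congrArg (fun e => d • e) hr
      simp only [vadd_eq_add, smul_add, smul_inv_smul₀ hd.ne'] at this ⊢
      linear_combination (norm := module) this
    intro p hp
    apply key
    rcases hp with rfl | rfl | rfl
    · exact hv _ (by simp)
    · exact hv _ (by simp)
    · exact hv _ (by simp)
  · have key : ∀ a b : E, (∀ q ∈ segment ℝ a b, ‖q - x‖ = d) →
        segment ℝ (d⁻¹ • (a - x)) (d⁻¹ • (b - x)) ⊆ Metric.sphere 0 1 := by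
      rintro a b h _ ⟨s, t, hs, ht, hst, rfl⟩
      have h1 := h (s • a + t • b) ⟨s, t, hs, ht, hst, rfl⟩
      have h2 : s • d⁻¹ • (a - x) + t • d⁻¹ • (b - x) = d⁻¹ • (s • a + t • b - x) := by
        obtain rfl : s = 1 - t := by linarith
        module
      rw [mem_sphere_zero_iff_norm, h2, norm_smul, h1, norm_inv, Real.norm_of_nonneg hd.le,
        inv_mul_cancel₀ hd.ne']
    exact Set.union_subset (key a b hab) (key b c hbc)

theorem segment_subset_union_of_mem {u v m : E} (hm : m ∈ segment ℝ u v) :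
    segment ℝ u v ⊆ segment ℝ u m ∪ segment ℝ m v := by
  rw [mem_segment_iff_wbtw] at hm
  intro q hq
  rw [mem_segment_iff_wbtw] at hq
  simp only [Set.mem_union, mem_segment_iff_wbtw]
  obtain ⟨s, hs, rfl⟩ := hm
  obtain ⟨t, ht, rfl⟩ := hq
  rcases le_total t s with h | h
  · left
    rcases eq_or_lt_of_le hs.1 with h0 | h0
    · obtain rfl : t = s := by linarith [ht.1]
      simp
    · refine ⟨t / s, ⟨by have := ht.1; positivity, by rw [div_le_one h0]; exact h⟩, ?_⟩
      simp only [AffineMap.lineMap_apply, vsub_eq_sub, vadd_eq_add, add_sub_cancel_right]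
      rw [smul_smul, div_mul_cancel₀ _ h0.ne']
  · right
    rcases eq_or_lt_of_le hs.2 with h0 | h0
    · obtain rfl : t = s := by linarith [ht.2]
      simp
    · have h1 : 0 < 1 - s := by linarith
      refine ⟨(t - s) / (1 - s), ⟨div_nonneg (by linarith) h1.le, ?_⟩, ?_⟩
      · rw [div_le_one h1]; linarith [ht.2]
      · simp only [AffineMap.lineMap_apply, vsub_eq_sub, vadd_eq_add]
        have h2 : (t - s) / (1 - s) * (1 - s) = t - s := div_mul_cancel₀ _ h1.ne'
        have h3 : ((t - s) / (1 - s)) • (v - (s • (v - u) + u)) =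
            ((t - s) / (1 - s) * (1 - s)) • (v - u) := by module
        rw [h3, h2]; module

/-- In a plane that is not angled, an arc of a sphere that is not a segment has a point joined to
neither end by a segment of the sphere. -/
theorem exists_between_not_segment (hE : ¬ IsAngled E) (hdim : Module.finrank ℝ E = 2) {x u v : E}
    {d : ℝ} (hd : 0 < d) (hu : ‖u - x‖ = d) (hv : ‖v - x‖ = d)
    (hli : LinearIndependent ℝ ![u - x, v - x])
    (huv : ¬ ∀ q ∈ segment ℝ u v, ‖q - x‖ = d) :
    ∃ r ∈ Set.Icc (0 : ℝ) 1, ∀ t : ℝ, 0 < t →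
      ‖t • ((1 - r) • (u - x) + r • (v - x))‖ = d →
      (¬ ∀ q ∈ segment ℝ u (x + t • ((1 - r) • (u - x) + r • (v - x))), ‖q - x‖ = d) ∧
      (¬ ∀ q ∈ segment ℝ (x + t • ((1 - r) • (u - x) + r • (v - x))) v, ‖q - x‖ = d) := by
  obtain ⟨φ, ψ, hφu, hφv, hψu, hψv, -⟩ := exists_coordinates hdim hli
  set m : ℝ → E := fun r => (1 - r) • (u - x) + r • (v - x) with hm
  have hmc : Continuous m := by fun_prop
  have hm0 : ∀ r, m r ≠ 0 := by
    intro r hr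
    have h1 := congrArg φ hr
    have h2 := congrArg ψ hr
    simp [hm, hφu, hφv, hψu, hψv] at h1 h2
    linarith
  have hn0 : ∀ r, ‖m r‖ ≠ 0 := fun r => norm_ne_zero_iff.2 (hm0 r)
  set q : ℝ → E := fun r => x + (d / ‖m r‖) • m r with hq
  have hqc : Continuous q := by
    refine continuous_const.add (Continuous.smul ?_ hmc)
    exact continuous_const.div hmc.norm hn0
  -- Otherwise `[0, 1]` is covered by two closed sets, according to the end to which `q r` is
  -- joined. By connectedness some `q r` is joined to both ends, so `u`, `q r`, `v` are collinear.
  by_contra! H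
  have hcover : Set.Icc (0 : ℝ) 1 ⊆
      {r | ∀ s ∈ Set.Icc (0 : ℝ) 1, ‖u + s • (q r - u) - x‖ = d} ∪
      {r | ∀ s ∈ Set.Icc (0 : ℝ) 1, ‖q r + s • (v - q r) - x‖ = d} := by
    intro r hr
    obtain ⟨t, ht, htd, h⟩ := H r hr
    have hqr : x + t • m r = q r := by
      rw [norm_smul, Real.norm_of_nonneg ht.le] at htd
      simp only [hq, ← htd]
      rw [mul_div_cancel_right₀ _ (hn0 r)]
    change (∃ q ∈ segment ℝ u (x + t • m r), ‖q - x‖ ≠ d) →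
      ∀ q ∈ segment ℝ (x + t • m r) v, ‖q - x‖ = d at h
    rw [hqr, segment_eq_image', segment_eq_image'] at h
    simp only [Set.forall_mem_image, Set.exists_mem_image] at h
    by_cases h1 : ∀ s ∈ Set.Icc (0 : ℝ) 1, ‖u + s • (q r - u) - x‖ = d
    · exact Or.inl h1
    · push Not at h1
      exact Or.inr fun s hs => h h1 hs
  have hclosed : ∀ f : ℝ → ℝ → E, (∀ s, Continuous fun r => f r s) →
      IsClosed {r | ∀ s ∈ Set.Icc (0 : ℝ) 1, ‖f r s‖ = d} := by
    intro f hf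
    simp only [Set.ofPred_forall]
    exact isClosed_biInter fun s _ => isClosed_eq (hf s).norm continuous_const
  have hq0 : q 0 = u := by
    have : m 0 = u - x := by simp [hm]
    simp [hq, this, hu, hd.ne']
  have hq1 : q 1 = v := by
    have : m 1 = v - x := by simp [hm]
    simp [hq, this, hv, hd.ne']
  obtain ⟨r, hr, hr1, hr2⟩ := isPreconnected_closed_iff.1 isPreconnected_Icc _ _
    (hclosed (fun r s => u + s • (q r - u) - x) fun s => by fun_prop)
    (hclosed (fun r s => q r + s • (v - q r) - x) fun s => by fun_prop) hcover
    ⟨0, by simp, fun s _ => by simp [hq0, hu]⟩ ⟨1, by simp, fun s _ => by simp [hq1, hv]⟩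
  have hs1 : ∀ p ∈ segment ℝ u (q r), ‖p - x‖ = d := by
    rw [segment_eq_image']
    rw [Set.forall_mem_image]
    exact hr1
  have hs2 : ∀ p ∈ segment ℝ (q r) v, ‖p - x‖ = d := by
    rw [segment_eq_image']
    rw [Set.forall_mem_image]
    exact hr2
  obtain ⟨w, hw⟩ := (collinear_iff_of_mem (Set.mem_insert _ _)).1
    (collinear_of_segments_subset_sphere hE hd hs1 hs2)
  obtain ⟨α, hα⟩ := hw (q r) (by simp)
  obtain ⟨β, hβ⟩ := hw v (by simp)
  rw [vadd_eq_add] at hα hβ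
  have hvu : v - u = β • w := by rw [hβ]; simp
  -- Relative to `x`, `φ + ψ` equals `1` on the line through `u` and `v`. Both `q r` and the chord
  -- point lie there and on one ray from `x`, so they coincide.
  have hw0 : (φ + ψ) w = 0 := by
    have h1 := congrArg (φ + ψ) hvu
    have h2 : v - u = (v - x) - (u - x) := by abel
    have hβ0 : β ≠ 0 := by
      rintro rfl
      have := congrArg φ hvu
      rw [h2] at this
      simp only [map_sub, zero_smul, map_zero] at this hφu hφv
      linarith
    rw [h2, map_sub, map_smul] at h1
    simp only [LinearMap.add_apply, hφu, hφv, hψu, hψv, smul_eq_mul] at h1 ⊢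
    have : β * (φ w + ψ w) = 0 := by linarith
    exact (mul_eq_zero.1 this).resolve_left hβ0
  have hκ : d / ‖m r‖ = 1 := by
    have h1 : (d / ‖m r‖) • m r = α • w + (u - x) := by
      have : q r - x = (d / ‖m r‖) • m r := by simp [hq]
      rw [← this, hα]; abel
    have h2 := congrArg (φ + ψ) h1
    rw [map_add, map_smul, map_smul, hw0] at h2
    simp only [hm, LinearMap.add_apply, map_add, map_smul, hφu, hφv, hψu, hψv, smul_eq_mul] at h2
    linarith
  have hqm : q r ∈ segment ℝ u v := by
    refine ⟨1 - r, r, by linarith [hr.2], hr.1, by ring, ?_⟩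
    have : q r = x + (d / ‖m r‖) • m r := rfl
    rw [this, hκ, hm]
    module
  exact huv fun p hp => (segment_subset_union_of_mem hqm hp).elim (hs1 p) (hs2 p)

end Normed

/-! ### Ball hulls and the sets of opposite points. -/

section Opposite

variable {E : Type*} [NormedAddCommGroup E]

/-- `C` has diameter at most `d > 0` and is the intersection of the closed balls of radius `d`
centred at the points of the compact set `S ⊆ C`. -/
structure IsBallHull (S C : Set E) (d : ℝ) : Prop where
  pos : 0 < d
  isCompact : IsCompact S
  subset : S ⊆ C
  norm_sub_le : ∀ x ∈ C, ∀ y ∈ C, ‖x - y‖ ≤ d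
  mem_iff : ∀ y, y ∈ C ↔ ∀ s ∈ S, ‖y - s‖ ≤ d

/-- The points of `C` at distance `d` from `x`. -/
def opposite (C : Set E) (d : ℝ) (x : E) : Set E := {y | y ∈ C ∧ ‖y - x‖ = d}

namespace IsBallHull

variable {S C : Set E} {d : ℝ}

theorem eq_iInter (H : IsBallHull S C d) : C = ⋂ s ∈ S, Metric.closedBall s d := by
  ext y
  simp [H.mem_iff, dist_eq_norm]

theorem isClosed (H : IsBallHull S C d) : IsClosed C := by
  rw [H.eq_iInter]
  exact isClosed_biInter fun s _ => Metric.isClosed_closedBall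

theorem isBounded (H : IsBallHull S C d) : Bornology.IsBounded C :=
  Metric.isBounded_iff.2 ⟨d, fun x hx y hy => by
    rw [dist_eq_norm]; exact H.norm_sub_le x hx y hy⟩

theorem isClosed_opposite (H : IsBallHull S C d) (x : E) : IsClosed (opposite C d x) :=
  H.isClosed.inter (isClosed_eq (by fun_prop) continuous_const)

theorem norm_lt (H : IsBallHull S C d) {x y : E} (hx : x ∈ C) (hy : y ∈ C)
    (h : y ∉ opposite C d x) : ‖y - x‖ < d :=
  (H.norm_sub_le y hy x hx).lt_of_ne fun h' => h ⟨hy, h'⟩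

variable [NormedSpace ℝ E]

theorem convex (H : IsBallHull S C d) : Convex ℝ C := by
  rw [H.eq_iInter]
  exact convex_iInter₂ fun s _ => convex_closedBall s d

theorem isCompact_hull [FiniteDimensional ℝ E] (H : IsBallHull S C d) : IsCompact C :=
  Metric.isCompact_of_isClosed_isBounded H.isClosed H.isBounded

/-- If the largest distance from `c` to the compact set `S` were below `d`, a small move along `v`
would stay in all the balls. -/
theorem exists_opposite_of_ray (H : IsBallHull S C d) {c v : E} (hc : c ∈ C) (hv : v ≠ 0)
    (h : ∀ t : ℝ, 0 < t → c + t • v ∉ C) : ∃ w ∈ S, ‖c - w‖ = d := by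
  have hv0 : 0 < ‖v‖ := norm_pos_iff.2 hv
  have hne : S.Nonempty := by
    rw [Set.nonempty_iff_ne_empty]
    rintro hS
    exact h 1 one_pos ((H.mem_iff _).2 (by simp [hS]))
  obtain ⟨w, hw, hmax⟩ := H.isCompact.exists_isMaxOn hne
    (f := fun s => ‖c - s‖) (by fun_prop)
  refine ⟨w, hw, ((H.mem_iff c).1 hc w hw).antisymm ?_⟩
  by_contra! hlt
  refine h ((d - ‖c - w‖) / ‖v‖) (div_pos (by linarith) hv0) ((H.mem_iff _).2 fun s hs => ?_)
  have h1 : ‖c - s‖ ≤ ‖c - w‖ := hmax hs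
  calc ‖c + ((d - ‖c - w‖) / ‖v‖) • v - s‖ = ‖(c - s) + ((d - ‖c - w‖) / ‖v‖) • v‖ := by
        congr 1; abel
    _ ≤ ‖c - s‖ + ‖((d - ‖c - w‖) / ‖v‖) • v‖ := norm_add_le _ _
    _ = ‖c - s‖ + (d - ‖c - w‖) := by
        rw [norm_smul, Real.norm_of_nonneg (div_nonneg (by linarith) hv0.le),
          div_mul_cancel₀ _ hv0.ne']
    _ ≤ d := by linarith

/-- The ray from `x` through `b` leaves `C` at `b`, since beyond it the distance to `x` exceeds `d`.
-/
theorem exists_opposite_of_opposite (H : IsBallHull S C d) {b x : E} (hx : x ∈ C)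
    (hb : b ∈ opposite C d x) : ∃ w ∈ S, ‖b - w‖ = d := by
  have hd := H.pos
  refine H.exists_opposite_of_ray hb.1 (v := b - x) ?_ fun t ht h => ?_
  · intro h0
    have := hb.2
    rw [h0, norm_zero] at this
    linarith
  · have h1 := H.norm_sub_le _ h x hx
    have h2 : b + t • (b - x) - x = (1 + t) • (b - x) := by module
    rw [h2, norm_smul, hb.2, Real.norm_of_nonneg (by linarith)] at h1
    nlinarith

/-- A ray from a point of `C` leaves `C` in a point that has an opposite point in `S`. -/
theorem exists_exit (H : IsBallHull S C d) {p v : E} (hp : p ∈ C) (hv : v ≠ 0) :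
    ∃ t : ℝ, 0 ≤ t ∧ p + t • v ∈ C ∧ (∀ t' : ℝ, 0 ≤ t' → p + t' • v ∈ C → t' ≤ t) ∧
      ∃ w ∈ S, ‖p + t • v - w‖ = d := by
  have hv0 : 0 < ‖v‖ := norm_pos_iff.2 hv
  have hcl : IsClosed {t : ℝ | p + t • v ∈ C} := H.isClosed.preimage (by fun_prop)
  have hsub : Set.Ici 0 ∩ {t : ℝ | p + t • v ∈ C} ⊆ Set.Icc 0 (d / ‖v‖) := by
    rintro t ⟨ht0, ht⟩
    refine ⟨ht0, ?_⟩
    rw [le_div_iff₀ hv0]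
    have := H.norm_sub_le _ ht p hp
    rwa [add_sub_cancel_left, norm_smul, Real.norm_of_nonneg ht0] at this
  obtain ⟨t, ⟨ht0, ht⟩, hmax⟩ := (isCompact_Icc.of_isClosed_subset
    (isClosed_Ici.inter hcl) hsub).exists_isGreatest ⟨0, Set.self_mem_Ici, by simpa using hp⟩
  refine ⟨t, ht0, ht, fun t' h0 h => hmax ⟨h0, h⟩, ?_⟩
  refine H.exists_opposite_of_ray ht hv fun s hs h => ?_
  rw [add_assoc, ← add_smul] at h
  have : t + s ≤ t := hmax ⟨Set.mem_Ici.2 (add_nonneg ht0 hs.le), h⟩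
  linarith

theorem norm_sub_eq_of_norming (H : IsBallHull S C d) {x u v : E} (hx : x ∈ C) (hu : u ∈ C)
    (hv : v ∈ C) {g : E →L[ℝ] ℝ} (hg : ∀ e, g e ≤ ‖e‖) (hgu : g (u - x) = d)
    (hgv : g (v - x) = d) {q : E} (hq : q ∈ segment ℝ u v) : ‖q - x‖ = d := by
  refine (H.norm_sub_le q (H.convex.segment_subset hu hv hq) x hx).antisymm ?_
  refine le_trans (le_of_eq ?_) (hg (q - x))
  obtain ⟨a, b, ha, hb, hab, rfl⟩ := hq
  simp only [map_sub, map_add, map_smul, smul_eq_mul] at *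
  obtain rfl : b = 1 - a := by linarith
  linear_combination -a * hgu - (1 - a) * hgv

/-- The chord `[c, w]` issuing from an exit point `c` between two points opposite to `x` has its
other end on neither side of the cone spanned by these points. -/
theorem coord_nonpos_of_exit (H : IsBallHull S C d) (hdim : Module.finrank ℝ E = 2) {x y₁ y₂ : E}
    (hx : x ∈ C) (h₁ : y₁ ∈ opposite C d x) (h₂ : y₂ ∈ opposite C d x) {r t : ℝ} (hr0 : 0 < r)
    (hr1 : r < 1) (ht : 0 < t) {c w : E} (hcx : c - x = t • ((1 - r) • (y₁ - x) + r • (y₂ - x)))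
    (hc : c ∈ C) (hw : w ∈ C) (hcw : ‖c - w‖ = d)
    (hns : ‖c - x‖ = d → ¬ ∀ q ∈ segment ℝ c y₂, ‖q - x‖ = d)
    {φ : E →ₗ[ℝ] ℝ} (hφ₁ : φ (y₁ - x) = 1) (hφ₂ : φ (y₂ - x) = 0) : φ (w - x) ≤ 0 := by
  by_contra! hφw
  have hd := H.pos
  rcases segments_meet_or_strip hdim hd (by rw [norm_sub_rev]; exact h₂.2) hcw
    (H.norm_sub_le x hx c hc) (H.norm_sub_le x hx w hw) (H.norm_sub_le _ h₂.1 c hc)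
    (H.norm_sub_le _ h₂.1 w hw) with ⟨p, hp, hp'⟩ | ⟨g, hg, g1, g2, g3, g4⟩ | ⟨g, hg, g1, g2, g3, g4⟩
  · rw [segment_eq_image'] at hp
    obtain ⟨s, -, rfl⟩ := hp
    obtain ⟨a, b, ha, hb, hab, h⟩ := hp'
    have h1 : a • (c - x) + b • (w - x) = s • (y₂ - x) := by
      obtain rfl : b = 1 - a := by linarith
      simp only at h
      linear_combination (norm := module) h
    have h2 := congrArg φ h1
    rw [map_add, map_smul, map_smul, map_smul, hφ₂, hcx, map_smul, map_add, map_smul, map_smul,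
      hφ₁, hφ₂] at h2
    simp only [smul_eq_mul, mul_zero, mul_one, add_zero] at h2
    have h3 : 0 < t * (1 - r) := mul_pos ht (by linarith)
    rcases ha.eq_or_lt with rfl | ha
    · obtain rfl : b = 1 := by linarith
      linarith
    · have := mul_pos ha h3
      have := mul_nonneg hb hφw.le
      linarith
  -- In this strip `g` vanishes on `c - x`, yet it is nonnegative on `y₁ - x` and equal to `d` on
  -- `y₂ - x`, so it is positive inside their cone.
  · have h1 : g (c - x) = 0 := by
      simp only [map_sub] at *
      linarith
    rw [hcx, map_smul, map_add, map_smul, map_smul, g1] at h1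
    have h2 := (mul_eq_zero.1 h1).resolve_left ht.ne'
    have h3 := (hg (y₂ - y₁)).trans (H.norm_sub_le _ h₂.1 _ h₁.1)
    have h4 : g (y₂ - x) = g (y₂ - y₁) + g (y₁ - x) := by rw [← map_add]; simp
    simp only [smul_eq_mul] at h2
    nlinarith [mul_pos hr0 hd]
  · have h1 : ‖c - x‖ = d := (H.norm_sub_le c hc x hx).antisymm (g3 ▸ hg _)
    exact hns h1 fun q hq => H.norm_sub_eq_of_norming hx hc h₂.1 hg g3 g1 hq

/-- In a plane that is not angled, the points opposite to a point outside `S` form a convex set. -/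
theorem segment_subset_opposite (H : IsBallHull S C d) (hdim : Module.finrank ℝ E = 2)
    (hE : ¬ IsAngled E) {x y₁ y₂ : E} (hx : x ∈ C) (hxS : x ∉ S) (h₁ : y₁ ∈ opposite C d x)
    (h₂ : y₂ ∈ opposite C d x) : segment ℝ y₁ y₂ ⊆ opposite C d x := by
  have hd := H.pos
  suffices h : ∀ q ∈ segment ℝ y₁ y₂, ‖q - x‖ = d from
    fun q hq => ⟨H.convex.segment_subset h₁.1 h₂.1 hq, h q hq⟩
  by_contra hns
  have hne : y₁ ≠ y₂ := by
    rintro rfl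
    refine hns fun q hq => ?_
    rw [segment_same] at hq
    rw [hq]
    exact h₁.2
  have hli : LinearIndependent ℝ ![y₁ - x, y₂ - x] :=
    linearIndependent_pair_of_norm_eq hd h₁.2 h₂.2 (by simpa using H.norm_sub_le _ h₁.1 _ h₂.1) (by simpa using hne)
  obtain ⟨φ, ψ, hφ₁, hφ₂, hψ₁, hψ₂, hco⟩ := exists_coordinates hdim hli
  obtain ⟨r, hr, hN⟩ := exists_between_not_segment hE hdim hd h₁.2 h₂.2 hli hns
  have hr0 : r ≠ 0 := by
    rintro rfl
    refine (hN 1 one_pos (by simpa using h₁.2)).1 fun q hq => ?_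
    simp at hq
    rw [hq, h₁.2]
  have hr1 : r ≠ 1 := by
    rintro rfl
    refine (hN 1 one_pos (by simpa using h₂.2)).2 fun q hq => ?_
    simp at hq
    rw [hq, h₂.2]
  replace hr0 := hr.1.lt_of_ne hr0.symm
  replace hr1 := hr.2.lt_of_ne hr1
  have hm0 : (1 - r) • (y₁ - x) + r • (y₂ - x) ≠ 0 := by
    intro h
    have := congrArg φ h
    rw [map_add, map_smul, map_smul, hφ₁, hφ₂] at this
    simp at this
    linarith
  obtain ⟨t, -, hc, htmax, w, hw, hcw⟩ := H.exists_exit hx hm0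
  have ht : 0 < t := by
    refine one_pos.trans_le (htmax 1 zero_le_one ?_)
    have : x + (1 : ℝ) • ((1 - r) • (y₁ - x) + r • (y₂ - x)) = (1 - r) • y₁ + r • y₂ := by module
    rw [this]
    exact H.convex h₁.1 h₂.1 (by linarith) hr0.le (by ring)
  have hwC := H.subset hw
  set c := x + t • ((1 - r) • (y₁ - x) + r • (y₂ - x)) with hcdef
  have hcx : c - x = t • ((1 - r) • (y₁ - x) + r • (y₂ - x)) := by simp [hcdef]
  have hφw := H.coord_nonpos_of_exit hdim hx h₁ h₂ hr0 hr1 ht hcx hc hwC hcw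
    (fun h => (hN t ht (hcx ▸ h)).2) hφ₁ hφ₂
  have hψw := H.coord_nonpos_of_exit hdim hx h₂ h₁ (r := 1 - r) (by linarith) (by linarith) ht
    (by rw [hcx]; module) hc hwC hcw
    (fun h => by rw [segment_symm]; exact (hN t ht (hcx ▸ h)).1) hψ₂ hψ₁
  have hwx := hco (w - x)
  set α := φ (w - x)
  set β := ψ (w - x)
  -- If `w - x` were a nonzero element of the negative cone, some `y` would be farther than `d` from
  -- `w`. Hence `w = x`, which contradicts `x ∉ S`.
  have key : ∀ y ∈ opposite C d x, ∀ y' ∈ opposite C d x, ∀ a b : ℝ, a < 0 → b ≤ 0 →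
      w - x = a • (y - x) + b • (y' - x) → False := by
    intro y hy y' hy' a b ha hb h
    have h1 : (1 - a - b) • (y - x) = (y - w) + (-b) • (y - y') := by
      linear_combination (norm := module) h
    have h2 : (1 - a - b) * d ≤ d + (-b) * d := by
      calc (1 - a - b) * d = ‖(1 - a - b) • (y - x)‖ := by
            rw [norm_smul, hy.2, Real.norm_of_nonneg (by linarith)]
        _ ≤ ‖y - w‖ + ‖(-b) • (y - y')‖ := by rw [h1]; exact norm_add_le _ _
        _ ≤ d + (-b) * d := by
            rw [norm_smul, Real.norm_of_nonneg (by linarith : 0 ≤ -b)]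
            gcongr
            · exact H.norm_sub_le y hy.1 w hwC
            · linarith
            · exact H.norm_sub_le y hy.1 y' hy'.1
    nlinarith
  rcases hφw.lt_or_eq with hα | hα
  · exact key y₁ h₁ y₂ h₂ α β hα hψw hwx
  rcases hψw.lt_or_eq with hβ | hβ
  · exact key y₂ h₂ y₁ h₁ β α hβ hφw (by rw [hwx]; abel)
  · rw [hα, hβ, zero_smul, zero_smul, add_zero, sub_eq_zero] at hwx
    exact hxS (hwx ▸ hw)

/-- By convexity the midpoint is also opposite to `x`, and a functional norming there is constant on
the segment. -/
theorem exists_supporting (H : IsBallHull S C d) (hdim : Module.finrank ℝ E = 2)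
    (hE : ¬ IsAngled E) {x y₁ y₂ : E} (hx : x ∈ C) (hxS : x ∉ S) (h₁ : y₁ ∈ opposite C d x)
    (h₂ : y₂ ∈ opposite C d x) :
    ∃ g : E →L[ℝ] ℝ, (∀ e, g e ≤ ‖e‖) ∧ g (y₁ - x) = d ∧ g (y₂ - x) = d := by
  have hm : midpoint ℝ y₁ y₂ ∈ openSegment ℝ y₁ y₂ := midpoint_mem_openSegment y₁ y₂
  obtain ⟨g, hg, hgm⟩ := exists_norming_functional (midpoint ℝ y₁ y₂ - x)
  have hm' := H.segment_subset_opposite hdim hE hx hxS h₁ h₂ (openSegment_subset_segment _ _ _ hm)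
  rw [hm'.2] at hgm
  exact ⟨g, hg,
    eq_of_norming_of_mem_openSegment hg hm h₁.2.le h₂.2.le hgm (left_mem_segment _ _ _),
    eq_of_norming_of_mem_openSegment hg hm h₁.2.le h₂.2.le hgm (right_mem_segment _ _ _)⟩

/-- Take two opposite points at maximal distance. Any third one is collinear with them because the
plane is not angled, and lies between them by maximality. -/
theorem opposite_eq_segment [FiniteDimensional ℝ E] (H : IsBallHull S C d)
    (hdim : Module.finrank ℝ E = 2) (hE : ¬ IsAngled E) {x : E} (hx : x ∈ C) (hxS : x ∉ S)
    (hne : (opposite C d x).Nonempty) :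
    ∃ b₁ ∈ opposite C d x, ∃ b₂ ∈ opposite C d x, opposite C d x = segment ℝ b₁ b₂ := by
  have hcpt : IsCompact (opposite C d x) :=
    H.isCompact_hull.of_isClosed_subset (H.isClosed_opposite x) fun _ h => h.1
  obtain ⟨⟨b₁, b₂⟩, ⟨h₁, h₂⟩, hmax⟩ := (hcpt.prod hcpt).exists_isMaxOn (hne.prod hne)
    (f := fun q : E × E => dist q.1 q.2) (by fun_prop)
  have hmax' : ∀ u ∈ opposite C d x, ∀ v ∈ opposite C d x, dist u v ≤ dist b₁ b₂ :=
    fun u hu v hv => hmax (Set.mk_mem_prod hu hv)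
  refine ⟨b₁, h₁, b₂, h₂, Set.Subset.antisymm (fun q hq => ?_)
    (H.segment_subset_opposite hdim hE hx hxS h₁ h₂)⟩
  have hcol := collinear_of_segments_subset_sphere hE H.pos
    (fun p hp => (H.segment_subset_opposite hdim hE hx hxS h₁ h₂ hp).2)
    (fun p hp => (H.segment_subset_opposite hdim hE hx hxS h₂ hq hp).2)
  rcases hcol.wbtw_or_wbtw_or_wbtw with h | h | h
  · have h1 := h.dist_add_dist
    have h2 := hmax' b₁ h₁ q hq
    have h3 : dist b₂ q = 0 := le_antisymm (by linarith) dist_nonneg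
    rw [← dist_eq_zero.1 h3]
    exact right_mem_segment _ _ _
  · rw [segment_symm, mem_segment_iff_wbtw]
    exact h
  · have h1 := h.dist_add_dist
    have h2 := hmax' q hq b₂ h₂
    have h3 : dist q b₁ = 0 := le_antisymm (by linarith) dist_nonneg
    rw [dist_eq_zero.1 h3]
    exact left_mem_segment _ _ _

/-- A point outside `S` is dominated by a point of `S`. -/
theorem exists_opposite_subset [FiniteDimensional ℝ E] (H : IsBallHull S C d)
    (hdim : Module.finrank ℝ E = 2) (hE : ¬ IsAngled E) {x : E} (hx : x ∈ C) (hxS : x ∉ S)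
    (hne : (opposite C d x).Nonempty) : ∃ s ∈ S, opposite C d x ⊆ opposite C d s := by
  obtain ⟨b₁, h₁, b₂, h₂, heq⟩ := H.opposite_eq_segment hdim hE hx hxS hne
  have hm : midpoint ℝ b₁ b₂ ∈ openSegment ℝ b₁ b₂ := midpoint_mem_openSegment b₁ b₂
  have hm' : midpoint ℝ b₁ b₂ ∈ opposite C d x := heq ▸ openSegment_subset_segment _ _ _ hm
  obtain ⟨s, hs, hds⟩ := H.exists_opposite_of_opposite hx hm'
  refine ⟨s, hs, fun q hq => ⟨hq.1, ?_⟩⟩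
  exact norm_sub_eq_of_mem_openSegment hm (H.norm_sub_le _ h₁.1 _ (H.subset hs))
    (H.norm_sub_le _ h₂.1 _ (H.subset hs)) hds (heq ▸ hq)

/-- A violation by `z` gives a supporting line of `C` at `b` containing a further point `y ∈ C` with
`‖y - x‖ < d`. At most two lines through `b` can contain a side of `C`, and each is ruled out once
`z` is close enough to `x`. -/
theorem exists_forall_opposite_subset_of_common (H : IsBallHull S C d)
    (hdim : Module.finrank ℝ E = 2) (hE : ¬ IsAngled E) {x b : E} (hx : x ∈ C)
    (hb : b ∈ opposite C d x) :
    ∃ ε > 0, ∀ z ∈ C, ‖z - x‖ < ε → z ∉ S → b ∈ opposite C d z →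
      opposite C d z ⊆ opposite C d x := by
  have hd := H.pos
  by_contra! hcon
  have bad : ∀ ε > 0, ∃ z y : E, ∃ g : E →L[ℝ] ℝ, z ∈ C ∧ ‖z - x‖ < ε ∧ y ∈ C ∧
      y ∉ opposite C d x ∧ y - b ≠ 0 ∧ (∀ e, g e ≤ ‖e‖) ∧ g (b - z) = d ∧ g (y - b) = 0 := by
    intro ε hε
    obtain ⟨z, hz, hzx, hzS, hbz, hsub⟩ := hcon ε hε
    obtain ⟨y, hy, hyx⟩ := Set.not_subset.1 hsub
    obtain ⟨g, hg, g1, g2⟩ := H.exists_supporting hdim hE hz hzS hbz hy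
    refine ⟨z, y, g, hz, hzx, hy.1, hyx, ?_, hg, g1, ?_⟩
    · rw [sub_ne_zero]
      rintro rfl
      exact hyx hb
    · simp only [map_sub] at *
      linarith
  -- A functional norming `b - z` attains its maximum over `C` at `b`.
  have nonneg : ∀ z ∈ C, ∀ k ∈ C, ∀ g : E →L[ℝ] ℝ, (∀ e, g e ≤ ‖e‖) → g (b - z) = d →
      g (k - b) ≤ 0 := by
    intro z hz k hk g hg g1
    have := (hg (k - z)).trans (H.norm_sub_le k hk z hz)
    simp only [map_sub] at *
    linarith
  have far : ∀ z k : E, ∀ g : E →L[ℝ] ℝ, (∀ e, g e ≤ ‖e‖) → g (b - z) = d →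
      ‖z - x‖ < d - ‖k - x‖ → g (k - b) ≠ 0 := by
    intro z k g hg g1 hzx g2
    have h1 := hg (k - z)
    have h2 := norm_sub_le_norm_sub_add_norm_sub k x z
    rw [norm_sub_rev x z] at h2
    simp only [map_sub] at *
    linarith
  obtain ⟨z₁, y₁, g₁, hz₁, -, hy₁, hyx₁, hne₁, hg₁, h11, h12⟩ := bad 1 one_pos
  have hlt₁ := H.norm_lt hx hy₁ hyx₁
  by_cases hli : ∃ z y : E, ∃ g : E →L[ℝ] ℝ, z ∈ C ∧ y ∈ C ∧ y ∉ opposite C d x ∧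
      (∀ e, g e ≤ ‖e‖) ∧ g (b - z) = d ∧ g (y - b) = 0 ∧ LinearIndependent ℝ ![y₁ - b, y - b]
  · obtain ⟨z₂, y₂, g₂, hz₂, hy₂, hyx₂, hg₂, h21, h22, hli⟩ := hli
    have hlt₂ := H.norm_lt hx hy₂ hyx₂
    obtain ⟨z, y, g, hz, hzx, hy, hyx, hne, hg, h1, h2⟩ :=
      bad (min (d - ‖y₁ - x‖) (d - ‖y₂ - x‖)) (lt_min (by linarith) (by linarith))
    obtain ⟨φ, ψ, -, -, -, -, hco⟩ := exists_coordinates hdim hli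
    have hyb := hco (y - b)
    set α := φ (y - b)
    set β := ψ (y - b)
    have f1 := far z y₁ g hg h1 (hzx.trans_le (min_le_left _ _))
    have f2 := far z y₂ g hg h1 (hzx.trans_le (min_le_right _ _))
    replace f1 := (nonneg z hz y₁ hy₁ g hg h1).lt_of_ne f1
    replace f2 := (nonneg z hz y₂ hy₂ g hg h1).lt_of_ne f2
    -- The supporting lines through `y₁` and `y₂` place `y - b` in the cone of `y₁ - b` and `y₂ -
    -- b`, where `g` vanishes only at the apex.
    have nz : ∀ g : E →L[ℝ] ℝ, g (y₁ - b) = 0 → g (y₂ - b) = 0 → ∀ e, g e = 0 := by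
      intro g e1 e2 e
      rw [hco e, map_add, map_smul, map_smul, e1, e2]
      simp
    have p1 : g₁ (y₂ - b) < 0 := (nonneg z₁ hz₁ y₂ hy₂ g₁ hg₁ h11).lt_of_ne fun h => by
      have := nz g₁ h12 h (b - z₁)
      linarith
    have p2 : g₂ (y₁ - b) < 0 := (nonneg z₂ hz₂ y₁ hy₁ g₂ hg₂ h21).lt_of_ne fun h => by
      have := nz g₂ h h22 (b - z₂)
      linarith
    have q1 := nonneg z₁ hz₁ y hy g₁ hg₁ h11
    have q2 := nonneg z₂ hz₂ y hy g₂ hg₂ h21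
    rw [hyb, map_add, map_smul, map_smul] at q1 q2 h2
    simp only [h12, h22, smul_eq_mul, mul_zero, zero_add, add_zero] at q1 q2 h2
    have hβ : 0 ≤ β := by nlinarith
    have hα : 0 ≤ α := by nlinarith
    have hα0 : α = 0 := by nlinarith [mul_nonneg hα (neg_nonneg.2 f1.le), mul_nonneg hβ (neg_nonneg.2 f2.le)]
    have hβ0 : β = 0 := by
      rw [hα0, zero_mul, zero_add] at h2
      exact (mul_eq_zero.1 h2).resolve_right f2.ne
    rw [hα0, hβ0, zero_smul, zero_smul, add_zero] at hyb
    exact hne hyb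
  · obtain ⟨z, y, g, hz, hzx, hy, hyx, hne, hg, h1, h2⟩ := bad (d - ‖y₁ - x‖) (by linarith)
    have h3 : ¬ LinearIndependent ℝ ![y₁ - b, y - b] := fun h =>
      hli ⟨z, y, g, hz, hy, hyx, hg, h1, h2, h⟩
    rw [LinearIndependent.pair_iff' hne₁] at h3
    push Not at h3
    obtain ⟨a, ha⟩ := h3
    rw [← ha, map_smul, smul_eq_mul] at h2
    rcases mul_eq_zero.1 h2 with rfl | h2
    · exact hne (by rw [← ha, zero_smul])
    · exact far z y₁ g hg h1 hzx h2

end IsBallHull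

end Opposite

/-! ### Local behaviour of the opposite sets. -/

section Local

variable {E : Type*} [NormedAddCommGroup E] [NormedSpace ℝ E]

namespace IsBallHull

variable {S C : Set E} {d : ℝ}

theorem norm_smul_add_le {U e : E} {d η a b : ℝ} (hU : ‖U‖ = d) (he : ‖e‖ ≤ η) (ha : 0 ≤ a)
    (hb : 0 ≤ b) : ‖a • U + b • e‖ ≤ a * d + b * η := by
  refine (norm_add_le _ _).trans ?_
  rw [norm_smul, norm_smul, hU, Real.norm_of_nonneg ha, Real.norm_of_nonneg hb]
  gcongr

theorem le_norm_smul_add {U e : E} {d η a b : ℝ} (hU : ‖U‖ = d) (he : ‖e‖ ≤ η) (hb : 0 ≤ b) :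
    a * d - b * η ≤ ‖a • U + b • e‖ := by
  have h1 : a * d ≤ ‖a • U‖ := by
    rw [norm_smul, hU]
    gcongr
    · exact hU ▸ norm_nonneg U
    · exact le_abs_self a
  have h2 : ‖b • e‖ ≤ b * η := by
    rw [norm_smul, Real.norm_of_nonneg hb]
    gcongr
  have h3 := norm_sub_norm_le (a • U) (-(b • e))
  rw [norm_neg, sub_neg_eq_add] at h3
  linarith

/-- Two nearby diameters with no common opposite points cross. -/
theorem exists_crossing (H : IsBallHull S C d) (hdim : Module.finrank ℝ E = 2) {x z b y : E}
    (hx : x ∈ C) (hz : z ∈ C) (hb : b ∈ opposite C d x) (hy : y ∈ opposite C d z)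
    (hdisj : Disjoint (opposite C d x) (opposite C d z)) (hη : ‖x - z‖ + ‖y - b‖ < d) :
    ∃ σ ∈ Set.Ico (0 : ℝ) 1, ∃ ρ ∈ Set.Ico (0 : ℝ) 1,
      x + σ • (b - x) = z + ρ • (y - z) := by
  have hd := H.pos
  have hby : b ≠ y := by
    rintro rfl
    exact Set.disjoint_left.1 hdisj hb hy
  rcases segments_meet_or_strip hdim hd (by rw [norm_sub_rev]; exact hb.2)
    (by rw [norm_sub_rev]; exact hy.2) (H.norm_sub_le x hx z hz) (H.norm_sub_le x hx y hy.1)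
    (H.norm_sub_le b hb.1 z hz) (H.norm_sub_le b hb.1 y hy.1)
    with ⟨p, hp, hp'⟩ | ⟨g, hg, g1, g2, g3, g4⟩ | ⟨g, hg, g1, g2, g3, g4⟩
  · obtain ⟨σ, hσ, hσp⟩ := (segment_eq_image' ℝ x b).subset hp
    obtain ⟨ρ, hρ, hρp⟩ := (segment_eq_image' ℝ z y).subset hp'
    simp only at hσp hρp
    have hxz : ∀ u ∈ opposite C d z, u ≠ x := by
      rintro u hu rfl
      have := hu.2
      linarith [norm_nonneg (y - b)]
    refine ⟨σ, ⟨hσ.1, hσ.2.lt_of_ne ?_⟩, ρ, ⟨hρ.1, hρ.2.lt_of_ne ?_⟩, hσp.trans hρp.symm⟩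
    -- If the crossing point were `b`, interior to `[z, y]`, all of `[z, y]` would be at distance
    -- `d` from `x`, making `y` a common opposite point.
    · rintro rfl
      obtain rfl : b = p := by rw [← hσp]; module
      rcases hρ.1.eq_or_lt with rfl | h0
      · rw [zero_smul, add_zero] at hρp
        have := hb.2
        rw [← hρp, norm_sub_rev] at this
        linarith [norm_nonneg (y - b)]
      rcases hρ.2.eq_or_lt with rfl | h1
      · exact hby (by rw [← hρp]; module)
      · have : b ∈ openSegment ℝ z y := by
          rw [openSegment_eq_image']
          exact ⟨ρ, ⟨h0, h1⟩, hρp⟩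
        exact Set.disjoint_left.1 hdisj ⟨hy.1, norm_sub_eq_of_mem_openSegment this
          (H.norm_sub_le z hz x hx) (H.norm_sub_le y hy.1 x hx) hb.2 (right_mem_segment _ _ _)⟩ hy
    · rintro rfl
      obtain rfl : y = p := by rw [← hρp]; module
      rcases hσ.1.eq_or_lt with rfl | h0
      · rw [zero_smul, add_zero] at hσp
        exact hxz y hy hσp.symm
      rcases hσ.2.eq_or_lt with rfl | h1
      · exact hby (by rw [← hσp]; module)
      · have : y ∈ openSegment ℝ x b := by
          rw [openSegment_eq_image']
          exact ⟨σ, ⟨h0, h1⟩, hσp⟩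
        exact Set.disjoint_left.1 hdisj hb ⟨hb.1, norm_sub_eq_of_mem_openSegment this
          (H.norm_sub_le x hx z hz) (H.norm_sub_le b hb.1 z hz) hy.2 (right_mem_segment _ _ _)⟩
  · have h1 : ‖y - x‖ = d := (H.norm_sub_le y hy.1 x hx).antisymm (g3 ▸ hg _)
    exact absurd hy (Set.disjoint_left.1 hdisj ⟨hy.1, h1⟩)
  · have h1 := hg (z - x)
    rw [norm_sub_rev] at h1
    linarith [norm_nonneg (y - b)]

/-- Between two crossing diameters there is a ray from the crossing point that contains no point
opposite to one of their end points. -/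
theorem exists_direction_avoiding [FiniteDimensional ℝ E] (H : IsBallHull S C d) {x z p U V : E}
    {T : ℝ} (hp : p ∈ C)
    (hpx : p ∉ opposite C d x) (hpz : p ∉ opposite C d z) (hx : x ∈ C) (hz : z ∈ C)
    (hdisj : Disjoint (opposite C d x) (opposite C d z))
    (hT : ∀ r ∈ Set.Icc (0 : ℝ) 1, ∀ t : ℝ, 0 ≤ t → p + t • ((1 - r) • U + r • V) ∈ C → t ≤ T)
    {t₀ t₁ : ℝ} (ht₀ : 0 ≤ t₀) (hU : p + t₀ • U ∈ opposite C d x) (ht₁ : 0 ≤ t₁)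
    (hV : p + t₁ • V ∈ opposite C d z) :
    ∃ r ∈ Set.Ioo (0 : ℝ) 1, ∀ t : ℝ, 0 ≤ t → p + t • ((1 - r) • U + r • V) ∉ opposite C d x ∧
      p + t • ((1 - r) • U + r • V) ∉ opposite C d z := by
  set f : ℝ × ℝ → E := fun q => p + q.2 • ((1 - q.1) • U + q.1 • V) with hf
  have hfc : Continuous f := by fun_prop
  -- The directions whose ray hits `opposite C d u` form a projection of a compact set; the bound
  -- `T` serves only for this. Connectedness then prevents two disjoint such sets from covering `[0,
  -- 1]`.
  have hclosed : ∀ u, IsClosed (Prod.fst '' ((Set.Icc (0 : ℝ) 1 ×ˢ Set.Icc (0 : ℝ) T) ∩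
      f ⁻¹' opposite C d u)) := fun u =>
    (((isCompact_Icc.prod isCompact_Icc).inter_right
      ((H.isClosed_opposite u).preimage hfc)).image continuous_fst).isClosed
  have hmem : ∀ u, ∀ r ∈ Set.Icc (0 : ℝ) 1, ∀ t : ℝ, 0 ≤ t → f (r, t) ∈ opposite C d u →
      r ∈ Prod.fst '' ((Set.Icc (0 : ℝ) 1 ×ˢ Set.Icc (0 : ℝ) T) ∩ f ⁻¹' opposite C d u) :=
    fun u r hr t ht h => ⟨(r, t), ⟨⟨hr, ht, hT r hr t ht h.1⟩, h⟩, rfl⟩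
  have h0 : f (0, t₀) ∈ opposite C d x := by simpa [hf] using hU
  have h1 : f (1, t₁) ∈ opposite C d z := by simpa [hf] using hV
  -- a ray from `p` cannot hit both sets of opposite points
  have hkey : ∀ r t t' : ℝ, 0 ≤ t → 0 ≤ t' → f (r, t) ∈ opposite C d x →
      f (r, t') ∈ opposite C d z → False := by
    have aux : ∀ u v : E, u ∈ C → p ∉ opposite C d u → ∀ r t t' : ℝ, 0 ≤ t → t < t' →
        f (r, t) ∈ opposite C d u → f (r, t') ∈ opposite C d v → False := by
      intro u v hu hpu r t t' ht htt h h'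
      rcases ht.eq_or_lt with rfl | ht0
      · exact hpu (by simpa [hf] using h)
      · have ht' : 0 < t' := ht0.trans htt
        have hm : f (r, t) ∈ openSegment ℝ p (f (r, t')) := by
          rw [openSegment_eq_image']
          refine ⟨t / t', ⟨div_pos ht0 ht', (div_lt_one ht').2 htt⟩, ?_⟩
          simp only [hf, add_sub_cancel_left]
          rw [smul_smul, div_mul_cancel₀ _ ht'.ne']
        exact hpu ⟨hp, norm_sub_eq_of_mem_openSegment hm (H.norm_sub_le p hp u hu)
          (H.norm_sub_le _ h'.1 u hu) h.2 (left_mem_segment _ _ _)⟩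
    intro r t t' ht ht' h h'
    rcases lt_trichotomy t t' with hlt | rfl | hlt
    · exact aux x z hx hpx r t t' ht hlt h h'
    · exact Set.disjoint_left.1 hdisj h h'
    · exact aux z x hz hpz r t' t ht' hlt h' h
  obtain ⟨r, hr, hrx, hrz⟩ : ∃ r ∈ Set.Icc (0 : ℝ) 1,
      (∀ t : ℝ, 0 ≤ t → f (r, t) ∉ opposite C d x) ∧
      ∀ t : ℝ, 0 ≤ t → f (r, t) ∉ opposite C d z := by
    by_contra! hcon
    obtain ⟨r, -, ⟨⟨r₁, s⟩, ⟨⟨-, hs, -⟩, h⟩, hr1⟩, ⟨⟨r₂, s'⟩, ⟨⟨-, hs', -⟩, h'⟩, hr2⟩⟩ :=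
      isPreconnected_closed_iff.1 isPreconnected_Icc _ _ (hclosed x) (hclosed z)
        (fun r hr => by
          by_cases h : ∀ t : ℝ, 0 ≤ t → f (r, t) ∉ opposite C d x
          · obtain ⟨t, ht, ht'⟩ := hcon r hr h
            exact Or.inr (hmem z r hr t ht ht')
          · push Not at h
            obtain ⟨t, ht, ht'⟩ := h
            exact Or.inl (hmem x r hr t ht ht'))
        ⟨0, by simp, hmem x 0 (by simp) t₀ ht₀ h0⟩ ⟨1, by simp, hmem z 1 (by simp) t₁ ht₁ h1⟩
    simp only at hr1 hr2
    subst hr1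
    subst hr2
    exact hkey _ s s' hs hs' h h'
  refine ⟨r, ⟨hr.1.lt_of_ne ?_, hr.2.lt_of_ne ?_⟩, fun t ht => ⟨hrx t ht, hrz t ht⟩⟩
  · rintro rfl
    exact hrx t₀ ht₀ h0
  · rintro rfl
    exact hrz t₁ ht₁ h1

/-- If a chord `[c, w]` of length `d` issues from a point `c` that lies on the far side of a
diameter `[x, b]` and is not opposite to `x`, then `w` lies on the other side of it. -/
theorem coord_le_of_chord (H : IsBallHull S C d) (hdim : Module.finrank ℝ E = 2) {x b c w V : E}
    (hx : x ∈ C) (hb : b ∈ opposite C d x) (hc : c ∈ C) (hcx : c ∉ opposite C d x) (hw : w ∈ C)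
    (hcw : ‖c - w‖ = d) (hV : ‖V - (b - x)‖ < d) {σ α β : ℝ} (hσ : 0 ≤ σ) (hα : 0 < α)
    (hβ : 0 ≤ β) (hce : c = x + σ • (b - x) + (β • (b - x) + α • V)) {ψ : E →ₗ[ℝ] ℝ}
    (hψ : ψ (b - x) = 0) (hψV : ψ V = 1) : ψ (w - x) ≤ 0 := by
  have hd := H.pos
  have hcx' : c - x = (σ + β) • (b - x) + α • V := by rw [hce]; module
  rcases segments_meet_or_strip hdim hd (by rw [norm_sub_rev]; exact hb.2) hcw
    (H.norm_sub_le x hx c hc) (H.norm_sub_le x hx w hw) (H.norm_sub_le _ hb.1 c hc)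
    (H.norm_sub_le _ hb.1 w hw) with ⟨p, hp, hp'⟩ | ⟨g, hg, g1, g2, g3, g4⟩ | ⟨g, hg, g1, g2, g3, g4⟩
  · rw [segment_eq_image'] at hp
    obtain ⟨s, -, rfl⟩ := hp
    obtain ⟨a, e, ha, he, hab, h⟩ := hp'
    have h1 : a • (c - x) + e • (w - x) = s • (b - x) := by
      obtain rfl : e = 1 - a := by linarith
      simp only at h
      linear_combination (norm := module) h
    have h2 := congrArg ψ h1
    rw [map_add, map_smul, map_smul, map_smul, hψ, hcx', map_add, map_smul, map_smul, hψ, hψV] at h2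
    simp only [smul_eq_mul, mul_zero, mul_one, zero_add] at h2
    by_contra! hlt
    rcases ha.eq_or_lt with rfl | ha
    · obtain rfl : e = 1 := by linarith
      linarith
    · have := mul_pos ha hα
      have := mul_nonneg he hlt.le
      linarith
  · exfalso
    have h1 : g (c - x) = 0 := by
      simp only [map_sub] at *
      linarith
    rw [hcx', map_add, map_smul, map_smul, g1] at h1
    have h2 := hg ((b - x) - V)
    rw [norm_sub_rev, map_sub, g1] at h2
    have h3 : 0 < g V := by linarith
    have := mul_pos hα h3
    have := mul_nonneg (add_nonneg hσ hβ) hd.le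
    simp only [smul_eq_mul] at h1
    linarith
  · exact absurd ⟨hc, (H.norm_sub_le c hc x hx).antisymm (g3 ▸ hg _)⟩ hcx

/-- Up to errors of order `η / d`, `E1` says `t + A ≥ 1`, `E2` says `A ≤ σ` and `E3` says `t ≤ 1 -
σ`; together they give `A = σ`. -/
theorem abs_mul_le_of_near {d η σ t r A β : ℝ} (hd : 0 < d) (hη0 : 0 ≤ η) (hη : η ≤ d / 2)
    (hσ : σ ≤ 1) (ht : 0 ≤ t) (ht2 : t ≤ 2) (hr : r ≤ 1) (hβ : 0 ≤ β)
    (hβA : β ≤ A) (E1 : d ≤ (t + A) * d + (t * r + β) * η) (E2 : (1 - σ + A) * d - β * η ≤ d)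
    (E3 : (σ + t) * d - t * r * η ≤ d) : |σ - A| * d ≤ 6 * η ∧ β * η ≤ 2 * η := by
  have hβη : β * η ≤ A * η := by gcongr
  have hAη : A * η ≤ A * (d / 2) := by gcongr; linarith
  have hσd : σ * d ≤ 1 * d := by gcongr
  have hA2 : A ≤ 2 := by
    by_contra! h
    have := mul_lt_mul_of_pos_right h hd
    linarith
  have e1 : A * η ≤ 2 * η := by gcongr
  have e2 : t * η ≤ 2 * η := by gcongr
  have e3 : t * r * η ≤ t * η := by
    gcongr
    exact mul_le_of_le_one_right ht hr
  refine ⟨?_, hβη.trans e1⟩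
  rw [← abs_of_pos hd, ← abs_mul, abs_le]
  constructor <;> linarith

/-- Two nearby diameters whose end points have no common opposite points force a point of `S`
close to them. -/
theorem exists_mem_near_of_disjoint [FiniteDimensional ℝ E] (H : IsBallHull S C d)
    (hdim : Module.finrank ℝ E = 2) {x z b y : E} (hx : x ∈ C) (hz : z ∈ C)
    (hb : b ∈ opposite C d x) (hy : y ∈ opposite C d z)
    (hdisj : Disjoint (opposite C d x) (opposite C d z)) {η : ℝ}
    (hη : ‖x - z‖ + ‖y - b‖ ≤ η) (hηd : η ≤ d / 2) : ∃ w ∈ S, ‖w - x‖ ≤ 8 * η := by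
  have hd := H.pos
  have hη0 : 0 ≤ η := le_trans (by positivity) hη
  obtain ⟨σ, hσ, ρ, hρ, hp⟩ := H.exists_crossing hdim hx hz hb hy hdisj (by linarith)
  set U := b - x with hUdef
  set V := y - z with hVdef
  set p := x + σ • U with hpdef
  have hU : ‖U‖ = d := hb.2
  have hV : ‖V‖ = d := hy.2
  have he : ‖V - U‖ ≤ η := by
    have : V - U = (y - b) + (x - z) := by rw [hUdef, hVdef]; abel
    rw [this]
    linarith [norm_add_le (y - b) (x - z)]
  -- Equal directions would put both diameters on one line; the bounds on `‖y - x‖` and `‖z - b‖`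
  -- then make them coincide.
  have hUV : U ≠ V := by
    intro h
    rw [← h] at hp
    have hzx : z = x + (σ - ρ) • U := by
      linear_combination (norm := module) -hp
    have h1 := H.norm_sub_le y hy.1 x hx
    have h2 := H.norm_sub_le z hz b hb.1
    have e1 : y - x = (1 + σ - ρ) • U := by
      have : y = z + U := by rw [h, hVdef]; abel
      rw [this, hzx]; module
    have e2 : z - b = (σ - ρ - 1) • U := by
      have : b = x + U := by rw [hUdef]; abel
      rw [this, hzx]; module
    rw [e1, norm_smul, hU, Real.norm_eq_abs] at h1
    rw [e2, norm_smul, hU, Real.norm_eq_abs] at h2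
    have h1' : |1 + σ - ρ| ≤ 1 := by nlinarith
    have h2' : |σ - ρ - 1| ≤ 1 := by nlinarith
    have : σ = ρ := by linarith [(abs_le.1 h1').2, (abs_le.1 h2').1]
    rw [this, sub_self, zero_smul, add_zero] at hzx
    rw [hzx] at hdisj
    exact Set.disjoint_left.1 hdisj hb hb
  have hli : LinearIndependent ℝ ![U, V] :=
    linearIndependent_pair_of_norm_eq hd hU hV (by rw [norm_sub_rev]; linarith) hUV
  obtain ⟨φ, ψ, hφU, hφV, hψU, hψV, hco⟩ := exists_coordinates hdim hli
  have hpC : p ∈ C := H.convex.segment_subset hx hb.1 (by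
    rw [segment_eq_image']
    exact ⟨σ, ⟨hσ.1, hσ.2.le⟩, rfl⟩)
  have hpx : p ∉ opposite C d x := by
    rintro ⟨-, h⟩
    rw [hpdef, add_sub_cancel_left, norm_smul, hU, Real.norm_of_nonneg hσ.1] at h
    nlinarith [hσ.2]
  have hpz : p ∉ opposite C d z := by
    rintro ⟨-, h⟩
    rw [hp, add_sub_cancel_left, norm_smul, hV, Real.norm_of_nonneg hρ.1] at h
    nlinarith [hρ.2]
  have hbp : p + (1 - σ) • U = b := by rw [hpdef, hUdef]; module
  have hyp : p + (1 - ρ) • V = y := by rw [hp, hVdef]; module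
  have hT : ∀ r ∈ Set.Icc (0 : ℝ) 1, ∀ t : ℝ, 0 ≤ t →
      p + t • ((1 - r) • U + r • V) ∈ C → t ≤ 2 := by
    intro r hr t ht h
    have h1 := H.norm_sub_le _ h p hpC
    have h2 : p + t • ((1 - r) • U + r • V) - p = t • U + (t * r) • (V - U) := by module
    rw [h2] at h1
    have h3 := le_norm_smul_add (a := t) hU he (mul_nonneg ht hr.1)
    have h4 : t * r * η ≤ t * (d / 2) := by
      have : r * η ≤ 1 * (d / 2) := mul_le_mul hr.2 hηd hη0 zero_le_one
      nlinarith
    nlinarith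
  obtain ⟨r, hr, hav⟩ := H.exists_direction_avoiding hpC hpx hpz hx hz hdisj hT
    (sub_nonneg.2 hσ.2.le) (hbp.symm ▸ hb) (sub_nonneg.2 hρ.2.le) (hyp.symm ▸ hy)
  have hD0 : (1 - r) • U + r • V ≠ 0 := by
    intro h
    have := congrArg ψ h
    rw [map_add, map_smul, map_smul, hψU, hψV] at this
    simp at this
    linarith [hr.1]
  obtain ⟨t, ht0, hc, htmax, w, hw, hcw⟩ := H.exists_exit hpC hD0
  have hwC := H.subset hw
  have ht : 0 < t := by
    have hε : 0 < min (1 - σ) (1 - ρ) := lt_min (by linarith [hσ.2]) (by linarith [hρ.2])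
    refine hε.trans_le (htmax _ hε.le ?_)
    set ε := min (1 - σ) (1 - ρ)
    have hm : ∀ q v : E, ∀ s : ℝ, p + s • v = q → q ∈ C → ε ≤ s → p + ε • v ∈ C := by
      intro q v s hq hqC hs
      have hs0 : 0 < s := hε.trans_le hs
      refine H.convex.segment_subset hpC hqC ?_
      rw [segment_eq_image']
      refine ⟨ε / s, ⟨by positivity, (div_le_one hs0).2 hs⟩, ?_⟩
      simp only [← hq, add_sub_cancel_left]
      rw [smul_smul, div_mul_cancel₀ _ hs0.ne']
    have h1 := hm b U _ hbp hb.1 (min_le_left _ _)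
    have h2 := hm y V _ hyp hy.1 (min_le_right _ _)
    have h3 : p + ε • ((1 - r) • U + r • V) = (1 - r) • (p + ε • U) + r • (p + ε • V) := by module
    rw [h3]
    exact H.convex h1 h2 (by linarith [hr.2]) hr.1.le (by ring)
  have ht2 := hT r ⟨hr.1.le, hr.2.le⟩ t ht0 hc
  obtain ⟨hcx, hcz⟩ := hav t ht0
  -- The chord from the exit point crosses both diameters, so `w = p - α U - β V` with `α, β ≥ 0`.
  -- Since `x = p - σ U` and `V` is near `U`, it remains to see that `α + β` is near `σ`.
  have hψw : ψ (w - x) ≤ 0 := H.coord_le_of_chord hdim hx hb hc hcx hwC hcw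
    (show ‖V - U‖ < d by linarith) (σ := σ) (α := t * r) (β := t * (1 - r)) hσ.1
    (mul_pos ht hr.1) (mul_nonneg ht0 (by linarith [hr.2])) (by rw [← hUdef, hpdef]; module)
    hψU hψV
  have hφw : φ (w - z) ≤ 0 := H.coord_le_of_chord hdim hz hy hc hcz hwC hcw
    (show ‖U - V‖ < d by rw [norm_sub_rev]; linarith) (σ := ρ) (α := t * (1 - r)) (β := t * r) hρ.1
    (mul_pos ht (by linarith [hr.2])) (mul_nonneg ht0 hr.1.le)
    (by rw [← hVdef, hp]; module) hφV hφU
  have hwp := hco (w - p)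
  have hψp : ψ (w - p) = ψ (w - x) := by
    have : w - p = (w - x) - σ • U := by rw [hpdef]; abel
    rw [this, map_sub, map_smul, hψU, smul_zero, sub_zero]
  have hφp : φ (w - p) = φ (w - z) := by
    have : w - p = (w - z) - ρ • V := by rw [hp]; abel
    rw [this, map_sub, map_smul, hφV, smul_zero, sub_zero]
  rw [hψp, hφp] at hwp
  obtain ⟨α, hα⟩ : ∃ α, φ (w - z) = -α := ⟨_, (neg_neg _).symm⟩
  obtain ⟨β, hβ⟩ : ∃ β, ψ (w - x) = -β := ⟨_, (neg_neg _).symm⟩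
  rw [hα] at hφw hwp
  rw [hβ] at hψw hwp
  have hα0 : 0 ≤ α := by linarith
  have hβ0 : 0 ≤ β := by linarith
  have E1 : d ≤ (t + (α + β)) * d + (t * r + β) * η := by
    have h : p + t • ((1 - r) • U + r • V) - w =
        (t + (α + β)) • U + (t * r + β) • (V - U) := by
      linear_combination (norm := module) -hwp
    rw [h] at hcw
    exact hcw.ge.trans
      (norm_smul_add_le hU he (by positivity) (by have := hr.1; positivity))
  have E2 : (1 - σ + (α + β)) * d - β * η ≤ d := by
    have h : b - w = (1 - σ + (α + β)) • U + β • (V - U) := by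
      linear_combination (norm := module) -hwp - hbp
    have := H.norm_sub_le b hb.1 w hwC
    rw [h] at this
    exact (le_norm_smul_add hU he hβ0).trans this
  have E3 : (σ + t) * d - t * r * η ≤ d := by
    have h : p + t • ((1 - r) • U + r • V) - x = (σ + t) • U + (t * r) • (V - U) := by
      rw [hpdef]; module
    have := H.norm_sub_le _ hc x hx
    rw [h] at this
    exact (le_norm_smul_add hU he (by have := hr.1; positivity)).trans this
  obtain ⟨h1, h2⟩ := abs_mul_le_of_near hd hη0 hηd hσ.2.le ht0 ht2 hr.2.le hβ0
    (by linarith) E1 E2 E3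
  refine ⟨w, hw, ?_⟩
  have h : w - x = (σ - (α + β)) • U + (-β) • (V - U) := by
    linear_combination (norm := module) hwp
  calc ‖w - x‖ ≤ ‖(σ - (α + β)) • U‖ + ‖(-β) • (V - U)‖ := by rw [h]; exact norm_add_le _ _
    _ ≤ 6 * η + β * η := by
      rw [norm_smul, norm_smul, hU, Real.norm_eq_abs, norm_neg, Real.norm_of_nonneg hβ0]
      gcongr
    _ ≤ 8 * η := by linarith

/-- Upper semicontinuity of the opposite set: on the compact part of `C` at distance at least `η`
from it, the distance to `x` has a maximum below `d`. -/
theorem exists_near_opposite [FiniteDimensional ℝ E] (H : IsBallHull S C d) {x : E} (hx : x ∈ C)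
    {η : ℝ} (hη : 0 < η) :
    ∃ ε > 0, ∀ z : E, ‖z - x‖ < ε → ∀ y ∈ opposite C d z, ∃ b ∈ opposite C d x, ‖y - b‖ < η := by
  set K := C ∩ ⋂ b ∈ opposite C d x, {y | η ≤ ‖y - b‖} with hK
  have hKc : IsCompact K := H.isCompact_hull.inter_right
    (isClosed_biInter fun b _ => isClosed_le continuous_const (by fun_prop))
  rcases K.eq_empty_or_nonempty with h0 | hne
  · refine ⟨1, one_pos, fun z _ y hy => ?_⟩
    by_contra! hcon
    have : y ∈ K := ⟨hy.1, by simpa using hcon⟩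
    rw [h0] at this
    exact this
  · obtain ⟨y₀, hy₀, hmax⟩ := hKc.exists_isMaxOn hne (f := fun y => ‖y - x‖) (by fun_prop)
    have hlt : ‖y₀ - x‖ < d := H.norm_lt hx hy₀.1 fun h => by
      have := Set.mem_iInter₂.1 hy₀.2 y₀ h
      simp at this
      linarith
    refine ⟨d - ‖y₀ - x‖, by linarith, fun z hz y hy => ?_⟩
    by_contra! hcon
    have h1 : ‖y - x‖ ≤ ‖y₀ - x‖ := hmax ⟨hy.1, by simpa using hcon⟩
    have h2 := norm_sub_le_norm_sub_add_norm_sub y x z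
    rw [hy.2, norm_sub_rev x z] at h2
    linarith

/-- Away from `S`, the set of opposite points is locally largest at each point. -/
theorem exists_forall_opposite_subset [FiniteDimensional ℝ E] (H : IsBallHull S C d)
    (hdim : Module.finrank ℝ E = 2) (hE : ¬ IsAngled E) {x : E} (hx : x ∈ C) (hxS : x ∉ S) :
    ∃ ε > 0, ∀ z ∈ C, ‖z - x‖ < ε → opposite C d z ⊆ opposite C d x := by
  have hd := H.pos
  obtain ⟨ρ, hρ, hball⟩ := Metric.isOpen_iff.1 H.isCompact.isClosed.isOpen_compl x hxS
  have hfar : ∀ w ∈ S, ρ ≤ ‖w - x‖ := by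
    intro w hw
    by_contra! hlt
    exact hball (mem_ball_iff_norm.2 hlt) hw
  -- `exists_mem_near_of_disjoint` is applied with `2 * η`: it needs `2 * η ≤ d / 2`, and its bound
  -- `16 * η` must be less than `ρ`.
  set η := min (ρ / 20) (d / 4) with hη
  have hη0 : 0 < η := lt_min (by linarith) (by linarith)
  have hη1 : η ≤ ρ / 20 := min_le_left _ _
  have hη2 : η ≤ d / 4 := min_le_right _ _
  obtain ⟨ε₀, hε₀, hnear⟩ := H.exists_near_opposite hx hη0
  rcases (opposite C d x).eq_empty_or_nonempty with h0 | hne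
  · refine ⟨ε₀, hε₀, fun z _ hzx y hy => ?_⟩
    obtain ⟨b, hb, -⟩ := hnear z hzx y hy
    rw [h0] at hb
    exact hb.elim
  obtain ⟨b₁, h₁, b₂, h₂, heq⟩ := H.opposite_eq_segment hdim hE hx hxS hne
  obtain ⟨ε₁, hε₁, hc₁⟩ := H.exists_forall_opposite_subset_of_common hdim hE hx h₁
  obtain ⟨ε₂, hε₂, hc₂⟩ := H.exists_forall_opposite_subset_of_common hdim hE hx h₂
  refine ⟨min (min ε₀ η) (min ρ (min ε₁ ε₂)), by positivity, fun z hz hzx y hy => ?_⟩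
  simp only [lt_min_iff] at hzx
  obtain ⟨⟨hz0, hzη⟩, hzρ, hz1, hz2⟩ := hzx
  have hzS : z ∉ S := fun h => (hfar z h).not_gt hzρ
  obtain ⟨b, hb, hyb⟩ := hnear z hz0 y hy
  have hnd : ¬ Disjoint (opposite C d x) (opposite C d z) := by
    intro hdisj
    obtain ⟨w, hw, hwx⟩ := H.exists_mem_near_of_disjoint hdim hx hz hb hy hdisj (η := 2 * η)
      (by rw [norm_sub_rev x z]; linarith) (by linarith)
    have := hfar w hw
    linarith
  obtain ⟨b', hb'x, hb'z⟩ := Set.not_disjoint_iff.1 hnd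
  -- A common point inside the segment makes the whole segment opposite to `z`, so a common end
  -- point may always be assumed.
  rw [heq, ← insert_endpoints_openSegment] at hb'x
  rcases hb'x with rfl | rfl | hb'
  · exact hc₁ z hz hz1 hzS hb'z hy
  · exact hc₂ z hz hz2 hzS hb'z hy
  · refine hc₁ z hz hz1 hzS ⟨h₁.1, ?_⟩ hy
    exact norm_sub_eq_of_mem_openSegment hb' (H.norm_sub_le _ h₁.1 z hz)
      (H.norm_sub_le _ h₂.1 z hz) hb'z.2 (left_mem_segment _ _ _)

/-- Every point outside `S` has a neighbourhood dominated by a single point of `S`. -/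
theorem exists_dominating [FiniteDimensional ℝ E] (H : IsBallHull S C d)
    (hdim : Module.finrank ℝ E = 2) (hE : ¬ IsAngled E) (hne : S.Nonempty) {x : E} (hx : x ∈ C)
    (hxS : x ∉ S) :
    ∃ s ∈ S, ∃ ε > 0, ∀ z ∈ C, ‖z - x‖ < ε → opposite C d z ⊆ opposite C d s := by
  obtain ⟨ε, hε, h⟩ := H.exists_forall_opposite_subset hdim hE hx hxS
  rcases (opposite C d x).eq_empty_or_nonempty with h0 | hO
  · obtain ⟨s, hs⟩ := hne
    exact ⟨s, hs, ε, hε, fun z hz hzx => (h z hz hzx).trans (h0 ▸ Set.empty_subset _)⟩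
  · obtain ⟨s, hs, hsub⟩ := H.exists_opposite_subset hdim hE hx hxS hO
    exact ⟨s, hs, ε, hε, fun z hz hzx => (h z hz hzx).trans hsub⟩

end IsBallHull

end Local

/-! ### Completions, Borsuk numbers and thickenings in metric spaces. -/

section Completion

variable {X : Type*} [PseudoMetricSpace X]

theorem exists_isCompletionOf {S : Set X} (hS : Bornology.IsBounded S) :
    ∃ C, IsCompletionOf C S := by
  obtain ⟨C, -, hC⟩ := zorn_subset_nonempty {D : Set X | S ⊆ D ∧ Metric.ediam D = Metric.ediam S}
    (fun c hc hchain hne => by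
      obtain ⟨D₀, hD₀⟩ := hne
      have hsub : S ⊆ ⋃₀ c := (hc hD₀).1.trans (Set.subset_sUnion_of_mem hD₀)
      refine ⟨⋃₀ c, ⟨hsub, le_antisymm (Metric.ediam_le ?_) (Metric.ediam_mono hsub)⟩,
        fun s hs => Set.subset_sUnion_of_mem hs⟩
      rintro x ⟨D, hD, hx⟩ y ⟨D', hD', hy⟩
      rcases hchain.total hD hD' with h | h
      · exact (Metric.edist_le_ediam_of_mem (h hx) hy).trans_eq (hc hD').2
      · exact (Metric.edist_le_ediam_of_mem hx (h hy)).trans_eq (hc hD).2)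
    S ⟨subset_rfl, rfl⟩
  refine ⟨C, ⟨?_, fun D hCD hD => hCD.2 ?_⟩, hC.prop.1, hC.prop.2⟩
  · rw [Metric.isBounded_iff_ediam_ne_top, hC.prop.2]
    exact Metric.isBounded_iff_ediam_ne_top.1 hS
  · exact hC.le_of_ge ⟨hC.prop.1.trans hCD.1, hD.trans hC.prop.2⟩ hCD.1

/-- Adding such a `y` to `S` keeps the diameter, so a completion of `insert y S` is one of `S`, that
is, `C`. -/
theorem mem_iff_of_uniqueCompletion {S C : Set X} (hS : IsSetOfUniqueCompletion S)
    (hC : IsCompletionOf C S) (y : X) : y ∈ C ↔ ∀ s ∈ S, edist y s ≤ Metric.ediam S := by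
  refine ⟨fun hy s hs => hC.2.2 ▸ Metric.edist_le_ediam_of_mem hy (hC.2.1 hs), fun hy => ?_⟩
  have hdiam : Metric.ediam (insert y S) = Metric.ediam S := by
    refine le_antisymm (Metric.ediam_le ?_) (Metric.ediam_mono (Set.subset_insert _ _))
    rintro a (rfl | ha) b (rfl | hb)
    · simp
    · exact hy b hb
    · rw [edist_comm]; exact hy a ha
    · exact Metric.edist_le_ediam_of_mem ha hb
  have hb : Bornology.IsBounded (insert y S) := (hC.1.1.subset hC.2.1).insert y
  obtain ⟨C', hC'⟩ := exists_isCompletionOf hb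
  have : C' = C := hS.unique
    ⟨hC'.1, (Set.subset_insert _ _).trans hC'.2.1, hC'.2.2.trans hdiam⟩ hC
  exact this ▸ hC'.2.1 (Set.mem_insert _ _)

/-- Some neighbourhood of `x` misses the finitely many closures not containing `x`; a point of `S`
in it supplies the `k` members. -/
theorem le_encard_closure {ι : Type*} [Finite ι] {k : ℕ} {S : Set X} {F : ι → Set X}
    (hF : ∀ x ∈ S, (k : ℕ∞) ≤ {i | x ∈ F i}.encard) {x : X} (hx : x ∈ closure S) :
    (k : ℕ∞) ≤ {i | x ∈ closure (F i)}.encard := by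
  have hopen : IsOpen (⋂ i ∈ {i | x ∉ closure (F i)}, (closure (F i))ᶜ) :=
    (Set.toFinite _).isOpen_biInter fun i _ => isClosed_closure.isOpen_compl
  obtain ⟨y, hy, hyS⟩ := mem_closure_iff.1 hx _ hopen (Set.mem_iInter₂.2 fun i hi => hi)
  refine (hF y hyS).trans (Set.encard_le_encard fun i hi => ?_)
  by_contra h
  exact Set.mem_iInter₂.1 hy i h (subset_closure hi)

theorem kFoldBorsukNumber_mono {S C : Set X} (hC : IsCompletionOf C S) (k : ℕ) :
    kFoldBorsukNumber k S ≤ kFoldBorsukNumber k C := by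
  refine le_sInf ?_
  rintro _ ⟨m, rfl, F, hF⟩
  refine sInf_le ⟨m, rfl, fun i => F i ∩ S, fun i => ⟨Set.inter_subset_right, ?_⟩, fun x hx => ?_⟩
  · exact (Metric.ediam_mono Set.inter_subset_left).trans_lt ((hF.1 i).2.trans_eq hC.2.2)
  · simpa [hx] using hF.2 x (hC.2.1 hx)

theorem kFoldBorsukNumber_le_of_extends {S C : Set X} {k : ℕ}
    (h : ∀ (m : ℕ) (F : Fin m → Set X), IsKFoldBorsukCovering k S F →
      ∃ G : Fin m → Set X, IsKFoldBorsukCovering k C G) :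
    kFoldBorsukNumber k C ≤ kFoldBorsukNumber k S := by
  refine le_sInf ?_
  rintro _ ⟨m, rfl, F, hF⟩
  exact sInf_le ⟨m, rfl, h m F hF⟩

theorem ediam_lt_of_isCompact {G : Set X} (hG : IsCompact G) {d : ℝ} (hd : 0 < d)
    (h : ∀ a ∈ G, ∀ b ∈ G, dist a b < d) : Metric.ediam G < ENNReal.ofReal d := by
  rcases G.eq_empty_or_nonempty with rfl | hne
  · simpa using hd
  · obtain ⟨⟨a, b⟩, ⟨ha, hb⟩, hmax⟩ := (hG.prod hG).exists_isMaxOn (hne.prod hne)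
      (f := fun q : X × X => dist q.1 q.2) (by fun_prop)
    refine lt_of_le_of_lt (Metric.ediam_le fun u hu v hv => ?_)
      ((ENNReal.ofReal_lt_ofReal_iff hd).2 (h a ha b hb))
    rw [edist_dist]
    exact ENNReal.ofReal_le_ofReal (hmax (Set.mk_mem_prod hu hv))

theorem exists_uniform_thickening {ι : Type*} [Finite ι] {F : ι → Set X} {d : ℝ}
    (hb : ∀ i, Bornology.IsBounded (F i)) (hd : ∀ i, Metric.diam (F i) < d) :
    ∃ δ > 0, ∀ i, ∀ a ∈ Metric.cthickening δ (F i), ∀ b ∈ Metric.cthickening δ (F i),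
      dist a b < d := by
  have h : ∀ i, ∀ᶠ δ : ℝ in nhdsWithin 0 (Set.Ioi 0), Metric.diam (F i) + 2 * δ < d := by
    intro i
    have hc : Filter.Tendsto (fun δ : ℝ => Metric.diam (F i) + 2 * δ) (nhdsWithin 0 (Set.Ioi 0))
        (nhds (Metric.diam (F i) + 2 * 0)) :=
      (Continuous.tendsto (by fun_prop) 0).mono_left nhdsWithin_le_nhds
    exact hc.eventually_lt_const (by simpa using hd i)
  obtain ⟨δ, hδ, hδ0⟩ := ((Filter.eventually_all.2 h).and self_mem_nhdsWithin).exists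
  refine ⟨δ, hδ0, fun i a ha c hc => ?_⟩
  calc dist a c ≤ Metric.diam (Metric.cthickening δ (F i)) :=
        Metric.dist_le_diam_of_mem (hb i).cthickening ha hc
    _ ≤ Metric.diam (F i) + 2 * δ := Metric.diam_cthickening_le _ (le_of_lt hδ0)
    _ < d := hδ i

/-- The degenerate case. An empty `S` is excluded, since its unique completion would be the whole
space. -/
theorem eq_of_ediam_eq_zero {Y : Type*} [MetricSpace Y] [Nontrivial Y] {S C : Set Y} (hS : IsSetOfUniqueCompletion S)
    (hC : IsCompletionOf C S) (h0 : Metric.ediam S = 0) : C = S := by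
  have hmem := mem_iff_of_uniqueCompletion hS hC
  refine Set.Subset.antisymm (fun y hy => ?_) hC.2.1
  rcases S.eq_empty_or_nonempty with rfl | ⟨s, hs⟩
  · have hsub : C.Subsingleton := Metric.ediam_eq_zero_iff.1 (hC.2.2.trans h0)
    have huniv : C = Set.univ := Set.eq_univ_of_forall fun y => (hmem y).2 (by simp)
    rw [huniv] at hsub
    exact absurd (Set.subsingleton_univ_iff.1 hsub) (not_subsingleton Y)
  · have := (hmem y).1 hy s hs
    rw [h0, nonpos_iff_eq_zero, edist_eq_zero] at this
    exact this ▸ hs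

end Completion

/-! ### Extending a covering from `S` to its completion. -/

section Main

variable {E : Type*} [NormedAddCommGroup E] [NormedSpace ℝ E]

theorem isBallHull_closure {S C : Set E} [FiniteDimensional ℝ E] (hS : IsSetOfUniqueCompletion S)
    (hC : IsCompletionOf C S) (hpos : Metric.ediam S ≠ 0) :
    IsBallHull (closure S) C (Metric.diam S) := by
  have hb : Bornology.IsBounded S := hC.1.1.subset hC.2.1
  have htop : Metric.ediam S ≠ ⊤ := Metric.isBounded_iff_ediam_ne_top.1 hb
  have hmem : ∀ y, y ∈ C ↔ ∀ s ∈ S, ‖y - s‖ ≤ Metric.diam S := by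
    intro y
    rw [mem_iff_of_uniqueCompletion hS hC]
    refine forall₂_congr fun s _ => ?_
    rw [← dist_eq_norm, dist_edist, Metric.diam, ENNReal.toReal_le_toReal (edist_ne_top _ _) htop]
  have hmem' : ∀ y, y ∈ C ↔ ∀ s ∈ closure S, ‖y - s‖ ≤ Metric.diam S := by
    intro y
    rw [hmem]
    refine ⟨fun h s hs => ?_, fun h s hs => h s (subset_closure hs)⟩
    have hcl : IsClosed {s | ‖y - s‖ ≤ Metric.diam S} := isClosed_le (by fun_prop) continuous_const
    exact closure_minimal h hcl hs
  have hle : ∀ x ∈ C, ∀ y ∈ C, ‖x - y‖ ≤ Metric.diam S := by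
    intro x hx y hy
    have h := Metric.dist_le_diam_of_mem hC.1.1 hx hy
    rwa [dist_eq_norm, Metric.diam, hC.2.2] at h
  refine ⟨ENNReal.toReal_pos hpos htop, hb.isCompact_closure, fun x hx => ?_, hle, hmem'⟩
  refine (hmem x).2 fun s hs => ?_
  have hcl : IsClosed {x | ‖x - s‖ ≤ Metric.diam S} := isClosed_le (by fun_prop) continuous_const
  exact closure_minimal (fun x hx => hle x (hC.2.1 hx) s (hC.2.1 hs)) hcl hx

theorem exists_covering_extension {S C : Set E} {ι : Type*} [Finite ι]
    (hdim : Module.finrank ℝ E = 2) (hE : ¬ IsAngled E) (hS : IsSetOfUniqueCompletion S)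
    (hC : IsCompletionOf C S) (hpos : Metric.ediam S ≠ 0) {k : ℕ} {F : ι → Set E}
    (hF : IsKFoldBorsukCovering k S F) :
    ∃ G : ι → Set E, IsKFoldBorsukCovering k C G := by
  have : FiniteDimensional ℝ E := Module.finite_of_finrank_eq_succ hdim
  have H := isBallHull_closure hS hC hpos
  have hd := H.pos
  have hb : Bornology.IsBounded S := hC.1.1.subset hC.2.1
  have htop : Metric.ediam S ≠ ⊤ := Metric.isBounded_iff_ediam_ne_top.1 hb
  have hdiam : Metric.ediam C = ENNReal.ofReal (Metric.diam S) := by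
    rw [hC.2.2, Metric.diam, ENNReal.ofReal_toReal htop]
  have hne : (closure S).Nonempty := by
    rw [closure_nonempty_iff, Set.nonempty_iff_ne_empty]
    rintro rfl
    simp at hpos
  have hCc := H.isCompact_hull
  obtain ⟨δ, hδ, hthick⟩ := exists_uniform_thickening (F := F) (d := Metric.diam S)
    (fun i => hb.subset (hF.1 i).1)
    (fun i => (ENNReal.toReal_lt_toReal (ne_top_of_lt (hF.1 i).2) htop).2 (hF.1 i).2)
  have hcl : ∀ i, closure (F i) ⊆ Metric.cthickening δ (F i) := fun i =>
    Metric.closure_subset_cthickening _ _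
  set K := C \ Metric.thickening δ S with hK
  have hKc : IsCompact K := hCc.diff Metric.isOpen_thickening
  -- Stated for all `x` so that `choose` yields total functions; the values outside `K` are
  -- irrelevant.
  have hdom : ∀ x, ∃ (s : E) (ε : ℝ), x ∈ K → s ∈ closure S ∧ 0 < ε ∧ ∀ z ∈ C, ‖z - x‖ < ε →
      opposite C (Metric.diam S) z ⊆ opposite C (Metric.diam S) s := by
    intro x
    by_cases hx : x ∈ K
    · obtain ⟨s, hs, ε, hε, h⟩ := H.exists_dominating hdim hE hne hx.1
        fun h => hx.2 (Metric.closure_subset_thickening hδ S h)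
      exact ⟨s, ε, fun _ => ⟨hs, hε, h⟩⟩
    · exact ⟨x, 1, fun h => absurd h hx⟩
  choose s ε hsε using hdom
  obtain ⟨t, htK, hcov⟩ := hKc.elim_nhds_subcover (fun x => Metric.closedBall x (ε x / 2))
    fun x hx => Metric.closedBall_mem_nhds x (half_pos (hsε x hx).2.1)
  have hball : ∀ x ∈ t, ∀ z ∈ C, z ∈ Metric.closedBall x (ε x / 2) →
      opposite C (Metric.diam S) z ⊆ opposite C (Metric.diam S) (s x) := by
    intro x hx z hz hzx
    have h := hsε x (htK x hx)
    refine h.2.2 z hz ?_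
    rw [mem_closedBall_iff_norm] at hzx
    linarith [h.2.1]
  set G : ι → Set E := fun i => C ∩ (Metric.cthickening δ (F i) ∪
    ⋃ x ∈ {x | x ∈ t ∧ s x ∈ closure (F i)}, Metric.closedBall x (ε x / 2)) with hG
  have hGc : ∀ i, IsCompact (G i) := fun i => hCc.inter_right
    (Metric.isClosed_cthickening.union (Set.Finite.isClosed_biUnion
      (t.finite_toSet.subset fun x hx => hx.1) fun x _ => Metric.isClosed_closedBall))
  have hopp : ∀ i, ∀ a ∈ G i, ∀ b ∈ G i, dist a b < Metric.diam S := by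
    -- If `b` is at distance `d` from `a`, it is so from `s x`. When `b` lies in another ball,
    -- around `x'`, domination applies again and puts `s x` at distance `d` from `s x'`. Both cases
    -- contradict `hthick`.
    have aux : ∀ i, ∀ x ∈ t, s x ∈ closure (F i) → ∀ a ∈ C, a ∈ Metric.closedBall x (ε x / 2) →
        ∀ b ∈ G i, dist a b ≠ Metric.diam S := by
      intro i x hx hsx a ha hax b hb hab
      rw [dist_comm, dist_eq_norm] at hab
      have h1 := hball x hx a ha hax ⟨hb.1, hab⟩
      rcases hb.2 with hb2 | hb2
      · have := hthick i b hb2 (s x) (hcl i hsx)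
        rw [dist_eq_norm, h1.2] at this
        exact lt_irrefl _ this
      · obtain ⟨x', ⟨hx', hsx'⟩, hbx'⟩ := Set.mem_iUnion₂.1 hb2
        have hsC : s x ∈ C := H.subset (hsε x (htK x hx)).1
        have h2 := hball x' hx' b hb.1 hbx' ⟨hsC, by rw [norm_sub_rev]; exact h1.2⟩
        have := hthick i (s x) (hcl i hsx) (s x') (hcl i hsx')
        rw [dist_eq_norm, h2.2] at this
        exact lt_irrefl _ this
    intro i a ha b hb
    refine lt_of_le_of_ne (by rw [dist_eq_norm]; exact H.norm_sub_le a ha.1 b hb.1) ?_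
    rcases ha.2 with ha2 | ha2
    · rcases hb.2 with hb2 | hb2
      · exact (hthick i a ha2 b hb2).ne
      · obtain ⟨x, ⟨hx, hsx⟩, hbx⟩ := Set.mem_iUnion₂.1 hb2
        rw [dist_comm]
        exact aux i x hx hsx b hb.1 hbx a ha
    · obtain ⟨x, ⟨hx, hsx⟩, hax⟩ := Set.mem_iUnion₂.1 ha2
      exact aux i x hx hsx a ha.1 hax b hb
  refine ⟨G, fun i => ⟨Set.inter_subset_left, ?_⟩, fun z hz => ?_⟩
  · rw [hdiam]
    exact ediam_lt_of_isCompact (hGc i) hd (hopp i)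
  -- Near `S`, the multiplicity is inherited from a nearby point of `S`; elsewhere, from the
  -- dominating point `s x ∈ closure S`.
  · by_cases hzS : z ∈ Metric.thickening δ S
    · obtain ⟨x, hx, hzx⟩ := Metric.mem_thickening_iff.1 hzS
      refine (hF.2 x hx).trans (Set.encard_le_encard fun i hi => ⟨hz, Or.inl ?_⟩)
      exact Metric.mem_cthickening_of_dist_le z x δ _ hi hzx.le
    · obtain ⟨x, hx, hzx⟩ := Set.mem_iUnion₂.1 (hcov ⟨hz, hzS⟩)
      refine (le_encard_closure hF.2 (hsε x (htK x hx)).1).trans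
        (Set.encard_le_encard fun i hi => ⟨hz, Or.inr ?_⟩)
      exact Set.mem_iUnion₂.2 ⟨x, ⟨hx, hi⟩, hzx⟩

end Main

end BorsukCovering

theorem mainTheorem6 {E : Type*} [NormedAddCommGroup E] [NormedSpace ℝ E]
    (hdim : Module.finrank ℝ E = 2) (hE : ¬ BorsukCovering.IsAngled E)
    (S C : Set E) (hS : BorsukCovering.IsSetOfUniqueCompletion S)
    (hC : BorsukCovering.IsCompletionOf C S) (k : ℕ) :
    BorsukCovering.kFoldBorsukNumber k S = BorsukCovering.kFoldBorsukNumber k C := by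
  by_cases h0 : Metric.ediam S = 0
  · have : Nontrivial E := Module.nontrivial_of_finrank_pos (R := ℝ) (by omega)
    rw [BorsukCovering.eq_of_ediam_eq_zero hS hC h0]
  · exact (BorsukCovering.kFoldBorsukNumber_mono hC k).antisymm
      (BorsukCovering.kFoldBorsukNumber_le_of_extends fun _ _ hF =>
        BorsukCovering.exists_covering_extension hdim hE hS hC h0 hF)
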